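/- Let $R>1$, let $B_r\subset\mathbb R^2$ be the open disk of radius $r$ centred at the origin, and let $\Omega_R=B_R\setminus\overline{B_1}$. Let $\widehat\theta$ be the angular unit vector, $\widehat\theta=(-\sin\theta,\cos\theta)$ at the point $\rho(\cos\theta,\sin\theta)$, and let $\Sigma_R=\{(x,0): 1<x<R\}$ with unit normal $\nu=(0,1)$. For $v\in H^1(\Omega_R;\mathbb R^2)$ the flux across $\Sigma_R$ is $\Phi_v=\int_{\Sigma_R}v\cdot\nu$, where $v$ on $\Sigma_R$ is meant in the trace sense. Let $$\mathbb H_\sigma(\Omega_R)=\{\varphi\in H^1_0(\Omega_R;\mathbb R^2)\;:\;\nabla\cdot\varphi=0\ \text{in }\Omega_R,\ \Phi_\varphi=0\}.$$ Given $\omega\ge 0$ and $f\in L^2(\Omega_R;\mathbb R^2)$, an incomplete solution of the system $$-\Delta u+(u\cdot\nabla)u+\nabla p=f,\quad \nabla\cdot u=0\ \text{ in }\Omega_R,\qquad u=\omega\,\widehat\theta\ \text{ on }\partial B_R,\qquad u=0\ \text{ on }\partial B_1,$$ is a vector field $u\in H^1(\Omega_R;\mathbb R^2)$ with $\nabla\cdot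 u=0$ in $\Omega_R$ that satisfies the two boundary conditions in the trace sense and $$\int_{\Omega_R}\nabla u\cdot\nabla\varphi+\int_{\Omega_R}(u\cdot\nabla)u\cdot\varphi=\int_{\Omega_R}f\cdot\varphi\qquad\text{for all }\varphi\in\mathbb H_\sigma(\Omega_R).$$ A vector field $v\in L^2(\Omega_R;\mathbb R^2)$ is rotationally invariant if, for every $\phi\in[0,2\pi]$, $v(\xi)=\mathcal R(\phi)^{\top}v(\mathcal R(\phi)\xi)$ for a.e. $\xi\in\Omega_R$, where $\mathcal R(\phi)$ is the rotation matrix about the origin by the angle $\phi$. **Theorem.** For every $R>1$, every $\omega\ge0$ and every rotationally invariant $f\in L^2(\Omega_R;\mathbb R^2)$, there exist infinitely many rotationally invariant incomplete solutions of the system above (fields that agree almost everywhere being identified). Moreover, for every $\Phi\in\mathbb R$ there is a rotationally invariant incomplete solution with flux $\Phi_u=\Phi$. -/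

import Mathlib

open MeasureTheory Filter Set
open scoped Topology

noncomputable section

namespace TaylorCouette

/-- The Euclidean plane. -/
abbrev Plane : Type := EuclideanSpace ℝ (Fin 2)

/-- The annulus `Ω_R = B_R \ closure B_1`, centred at the origin. -/
def annulus (R : ℝ) : Set Plane := Metric.ball 0 R \ Metric.closedBall 0 1

/-- Lebesgue measure on the annulus. -/
abbrev annulusMeasure (R : ℝ) : Measure Plane := volume.restrict (annulus R)

/-- The rotation matrix by the angle `φ`. -/
def rotMatrix (φ : ℝ) : Matrix (Fin 2) (Fin 2) ℝ :=
  !![Real.cos φ, -Real.sin φ; Real.sin φ, Real.cos φ]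

/-- Rotational invariance of (the almost everywhere class of) a vector field on the annulus:
`v(ξ) = R(φ)ᵀ v(R(φ) ξ)` for every angle `φ` and almost every `ξ`. -/
def RotInvariant (R : ℝ) (v : Plane → Plane) : Prop :=
  ∀ φ ∈ Icc (0 : ℝ) (2 * Real.pi), ∀ᵐ ξ ∂(annulusMeasure R),
    v ξ = Matrix.toEuclideanLin (rotMatrix φ).transpose
      (v (Matrix.toEuclideanLin (rotMatrix φ) ξ))

/-- The standard basis of the plane. -/
def basisVec (i : Fin 2) : Plane := EuclideanSpace.single i 1

/-- `Du 0`, `Du 1` are the weak (distributional) partial derivatives of the vector field `u`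
in `Ω`. -/
def IsWeakDeriv (Ω : Set Plane) (u : Plane → Plane) (Du : Fin 2 → Plane → Plane) : Prop :=
  ∀ ψ : Plane → ℝ, ContDiff ℝ (⊤ : ℕ∞) ψ → HasCompactSupport ψ → tsupport ψ ⊆ Ω →
    ∀ i, ∫ x in Ω, fderiv ℝ ψ x (basisVec i) • u x = - ∫ x in Ω, ψ x • Du i x

/-- `u ∈ H¹(Ω)`, with weak partial derivatives `Du`. -/
structure IsH1 (Ω : Set Plane) (u : Plane → Plane) (Du : Fin 2 → Plane → Plane) : Prop where
  memLp : MemLp u 2 (volume.restrict Ω)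
  memLp_deriv : ∀ i, MemLp (Du i) 2 (volume.restrict Ω)
  weakDeriv : IsWeakDeriv Ω u Du

/-- The sequence `w` of smooth fields converges in `H¹(Ω)` to `u`, whose weak partial
derivatives are `Du`. -/
def TendstoH1 (Ω : Set Plane) (w : ℕ → Plane → Plane) (u : Plane → Plane)
    (Du : Fin 2 → Plane → Plane) : Prop :=
  Tendsto (fun n => eLpNorm (fun x => w n x - u x) 2 (volume.restrict Ω)) atTop (𝓝 0) ∧
  ∀ i, Tendsto (fun n => eLpNorm (fun x => fderiv ℝ (w n) x (basisVec i) - Du i x) 2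
    (volume.restrict Ω)) atTop (𝓝 0)

/-- `u ∈ H¹₀(Ω)`, with weak partial derivatives `Du`: `H¹₀(Ω)` is the closure of the smooth fields with
compact support in `Ω`. -/
structure IsH10 (Ω : Set Plane) (u : Plane → Plane) (Du : Fin 2 → Plane → Plane) : Prop
    extends IsH1 Ω u Du where
  approx : ∃ w : ℕ → Plane → Plane,
    (∀ n, ContDiff ℝ (⊤ : ℕ∞) (w n) ∧ HasCompactSupport (w n) ∧ tsupport (w n) ⊆ Ω) ∧
    TendstoH1 Ω w u Du

/-- The field `u ∈ H¹(Ω)` with weak partial derivatives `Du` has trace `g` along the curve `γ`, `a < t < b`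
(used below only for curves of constant nonzero speed). The trace is the continuous extension to
`H¹(Ω)` of the restriction of functions which are smooth up to the boundary, so `g` is the
`L²`-limit of the restrictions of smooth fields which converge to `u` in `H¹(Ω)`. -/
def HasTrace (Ω : Set Plane) (u : Plane → Plane) (Du : Fin 2 → Plane → Plane)
    (γ : ℝ → Plane) (a b : ℝ) (g : ℝ → Plane) : Prop :=
  MemLp g 2 (volume.restrict (Ioo a b)) ∧
  ∃ w : ℕ → Plane → Plane, (∀ n, ContDiff ℝ (⊤ : ℕ∞) (w n)) ∧ TendstoH1 Ω w u Du ∧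
    Tendsto (fun n => eLpNorm (fun t => w n (γ t) - g t) 2 (volume.restrict (Ioo a b)))
      atTop (𝓝 0)

/-- The circle of radius `r`, parametrized by the angle. -/
def circlePath (r : ℝ) (t : ℝ) : Plane := !₂[r * Real.cos t, r * Real.sin t]

/-- The angular unit vector at the angle `t`. -/
def thetaHat (t : ℝ) : Plane := !₂[-Real.sin t, Real.cos t]

/-- The parametrization of the cut `Σ_R = {(x, 0) : 1 < x < R}` by `x`. -/
def cutPath (t : ℝ) : Plane := !₂[t, 0]

/-- The field `v ∈ H¹(Ω_R)` with weak partial derivatives `Dv` has flux `∫_{Σ_R} v · ν = Φ` across the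
cut, where `ν = (0, 1)` is the angular direction on the cut and `v` is taken in the trace sense. -/
def HasFlux (R : ℝ) (v : Plane → Plane) (Dv : Fin 2 → Plane → Plane) (Φ : ℝ) : Prop :=
  ∃ g : ℝ → Plane, HasTrace (annulus R) v Dv cutPath 1 R g ∧ ∫ t in Ioo 1 R, g t 1 = Φ

/-- The divergence `∂₁ v₁ + ∂₂ v₂`. -/
def divOf (Dv : Fin 2 → Plane → Plane) (x : Plane) : ℝ := ∑ i, Dv i x i

/-- The product `∇u · ∇φ = ∑ᵢⱼ ∂ᵢ uⱼ ∂ᵢ φⱼ`. -/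
def gradProd (Du Dφ : Fin 2 → Plane → Plane) (x : Plane) : ℝ :=
  ∑ i, ∑ j, Du i x j * Dφ i x j

/-- The convective term `(u · ∇) u = ∑ᵢ uᵢ ∂ᵢ u`. -/
def convective (u : Plane → Plane) (Du : Fin 2 → Plane → Plane) (x : Plane) : Plane :=
  ∑ i, u x i • Du i x

/-- The test fields: divergence-free fields of `H¹₀(Ω_R)` with zero flux across the cut. -/
structure IsTestField (R : ℝ) (φ : Plane → Plane) (Dφ : Fin 2 → Plane → Plane) : Prop where
  h10 : IsH10 (annulus R) φ Dφ
  div_free : ∀ᵐ x ∂(annulusMeasure R), divOf Dφ x = 0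
  flux : HasFlux R φ Dφ 0

/-- `u`, with weak partial derivatives `Du`, is an incomplete solution of the steady Navier-Stokes system in
`Ω_R` with force `f`, at rest on the inner circle and with velocity `ω θ̂` on the outer one. -/
structure IsIncompleteSolutionWith (R ω : ℝ) (f u : Plane → Plane)
    (Du : Fin 2 → Plane → Plane) : Prop where
  h1 : IsH1 (annulus R) u Du
  div_free : ∀ᵐ x ∂(annulusMeasure R), divOf Du x = 0
  inner_bc : HasTrace (annulus R) u Du (circlePath 1) 0 (2 * Real.pi) (fun _ => 0)
  outer_bc : HasTrace (annulus R) u Du (circlePath R) 0 (2 * Real.pi) (fun t => ω • thetaHat t)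
  weak_eq : ∀ (φ : Plane → Plane) (Dφ : Fin 2 → Plane → Plane), IsTestField R φ Dφ →
    (∫ x in annulus R, gradProd Du Dφ x) + (∫ x in annulus R, inner ℝ (convective u Du x) (φ x))
      = ∫ x in annulus R, inner ℝ (f x) (φ x)

/-- `u` is an incomplete solution. -/
def IsIncompleteSolution (R ω : ℝ) (f u : Plane → Plane) : Prop :=
  ∃ Du : Fin 2 → Plane → Plane, IsIncompleteSolutionWith R ω f u Du

/-- `u` is an incomplete solution with flux `Φ` across the cut. -/
def IsIncompleteSolutionWithFlux (R ω : ℝ) (f u : Plane → Plane) (Φ : ℝ) : Prop :=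
  ∃ Du : Fin 2 → Plane → Plane, IsIncompleteSolutionWith R ω f u Du ∧ HasFlux R u Du Φ

end TaylorCouette

end

/-! The solutions are swirling fields `u = V(‖x‖²) x^⊥`, where `x^⊥` is the quarter turn of `x`.
For such a field the convective term is the radial field `-V² x`, and with `s = ‖x‖²` the Laplacian
is `(4 / s) (s² V')' x^⊥`. Averaging over circles shows that an invariant force is
`F(‖x‖²) x^⊥ + G(‖x‖²) x` almost everywhere (`RotInvariant.exists_radial`). The radial parts of the
equation are gradients, which divergence-free fields of `H¹₀` do not see (`integral_radial_force`).
The angular part is the linear equation `-4 (s² V')' = s F + c`, where the constant `c` is free: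
it multiplies `x^⊥ / ‖x‖²`, whose potential is the multivalued polar angle, and this field is
orthogonal to the test fields because they carry no flux (`IsTestField.integral_perp`). Together
with the constant of integration there are two parameters, which are fixed by the velocity on the
outer circle and by the flux (`exists_profile`); the `2 × 2` system for them is nonsingular because
`2 log R < R - 1 / R`. Hence there is one such solution for each flux, and different fluxes give
different fields.

The force is only square integrable, so `s² V'` is only absolutely continuous. All integrations by
parts are reduced to one identity for a radial function against a divergence, `integral_mul_divOf`,
obtained from the continuous case by density in `L¹`. Identities for test fields are identities
between bounded functionals on `H¹` (`h1Functional`), checked on smooth fields and passed to the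
limit. The trace on the cut is treated in the same way: in polar coordinates, integration by parts
against a sawtooth in the angle writes the flux of a smooth field as such a functional
(`HasFlux.eq_integral`). Conversely, `V'` is continuous, and replacing it by Weierstrass polynomials
gives polynomial fields which converge to `u` in `H¹` and uniformly, so that the traces of `u` are
its restrictions (`hasTrace_swirl`). -/

namespace TaylorCouette

/-! ### The plane and the annulus -/

/-- Rotation by a quarter turn, `(x, y) ↦ (-y, x)`; the value at `x` is written `x^⊥` below. -/
noncomputable def perp : Plane →L[ℝ] Plane :=
  LinearMap.toContinuousLinearMap
    { toFun := fun x => !₂[-x 1, x 0]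
      map_add' := fun x y => by ext i; fin_cases i <;> simp [add_comm]
      map_smul' := fun c x => by ext i; fin_cases i <;> simp }

@[simp] lemma perp_apply_zero (x : Plane) : perp x 0 = -x 1 := by simp [perp]

@[simp] lemma perp_apply_one (x : Plane) : perp x 1 = x 0 := by simp [perp]

lemma inner_eq (x y : Plane) : inner ℝ x y = x 0 * y 0 + x 1 * y 1 := by
  simp [PiLp.inner_apply, Fin.sum_univ_two, mul_comm]

lemma norm_sq_eq (x : Plane) : ‖x‖ ^ 2 = x 0 ^ 2 + x 1 ^ 2 := by
  simp [EuclideanSpace.real_norm_sq_eq, Fin.sum_univ_two]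

@[simp] lemma basisVec_apply (i j : Fin 2) : basisVec i j = if j = i then 1 else 0 := by
  simp [basisVec]

lemma norm_basisVec (i : Fin 2) : ‖basisVec i‖ = 1 := by simp [basisVec]

/-- Expansion of a linear map in the standard basis. -/
lemma map_eq_basisVec {E : Type*} [NormedAddCommGroup E] [NormedSpace ℝ E] (L : Plane →L[ℝ] E)
    (x : Plane) : L x = x 0 • L (basisVec 0) + x 1 • L (basisVec 1) := by
  rw [← map_smul, ← map_smul, ← map_add]
  congr 1
  ext i
  fin_cases i <;> simp

lemma mem_annulus {R : ℝ} {x : Plane} : x ∈ annulus R ↔ 1 < ‖x‖ ∧ ‖x‖ < R := by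
  simp [annulus, and_comm]

lemma isOpen_annulus (R : ℝ) : IsOpen (annulus R) :=
  Metric.isOpen_ball.sdiff Metric.isClosed_closedBall

lemma measurableSet_annulus (R : ℝ) : MeasurableSet (annulus R) := (isOpen_annulus R).measurableSet

instance (R : ℝ) : IsFiniteMeasure (annulusMeasure R) :=
  isFiniteMeasure_restrict.2
    ((measure_mono sdiff_subset).trans_lt measure_ball_lt_top).ne

/-- The closed annulus, the closure of `annulus R`. -/
def closedAnnulus (R : ℝ) : Set Plane := Metric.closedBall 0 R \ Metric.ball 0 1

lemma mem_closedAnnulus {R : ℝ} {x : Plane} : x ∈ closedAnnulus R ↔ 1 ≤ ‖x‖ ∧ ‖x‖ ≤ R := by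
  simp [closedAnnulus, and_comm]

lemma annulus_subset_closedAnnulus (R : ℝ) : annulus R ⊆ closedAnnulus R := fun x hx => by
  rw [mem_annulus] at hx
  exact mem_closedAnnulus.2 ⟨hx.1.le, hx.2.le⟩

lemma isCompact_closedAnnulus (R : ℝ) : IsCompact (closedAnnulus R) :=
  (isCompact_closedBall 0 R).diff Metric.isOpen_ball

lemma norm_ne_zero_of_mem {R : ℝ} {x : Plane} (hx : x ∈ closedAnnulus R) : ‖x‖ ≠ 0 := by
  have := (mem_closedAnnulus.1 hx).1
  positivity

lemma norm_sq_mem_Icc {R : ℝ} {x : Plane} (hx : x ∈ closedAnnulus R) :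
    ‖x‖ ^ 2 ∈ Icc 1 (R ^ 2) := by
  have := mem_closedAnnulus.1 hx
  constructor <;> nlinarith

lemma norm_sq_mem_Ioo {R : ℝ} {x : Plane} (hx : x ∈ annulus R) : ‖x‖ ^ 2 ∈ Ioo 1 (R ^ 2) := by
  have := mem_annulus.1 hx
  constructor <;> nlinarith

lemma memLp_of_continuousOn {E : Type*} [NormedAddCommGroup E] {R : ℝ} {g : Plane → E}
    (hg : ContinuousOn g (closedAnnulus R)) (p : ENNReal) : MemLp g p (annulusMeasure R) := by
  obtain ⟨C, hC⟩ := (isCompact_closedAnnulus R).exists_bound_of_continuousOn hg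
  refine MemLp.of_bound ?_ C ?_
  · exact (hg.mono (annulus_subset_closedAnnulus R)).aestronglyMeasurable (measurableSet_annulus R)
  · filter_upwards [ae_restrict_mem (measurableSet_annulus R)] with x hx
    exact hC x (annulus_subset_closedAnnulus R hx)

lemma memLp_bdd_smul {R : ℝ} {k : Plane → ℝ} {g : Plane → Plane} {C : ℝ}
    (hk : AEStronglyMeasurable k (annulusMeasure R)) (hkC : ∀ x, |k x| ≤ C)
    (hg : MemLp g 2 (annulusMeasure R)) :
    MemLp (fun x => k x • g x) 2 (annulusMeasure R) :=
  hg.smul (MemLp.of_bound hk C (ae_of_all _ hkC) : MemLp k ⊤ _)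

lemma integrable_inner_of_memLp {α : Type*} [MeasurableSpace α] {μ : Measure α} {u v : α → Plane}
    (hu : MemLp u 2 μ) (hv : MemLp v 2 μ) : Integrable (fun x => inner ℝ (u x) (v x)) μ := by
  have := L2.integrable_inner (𝕜 := ℝ) (hu.toLp u) (hv.toLp v)
  refine this.congr ?_
  filter_upwards [hu.coeFn_toLp, hv.coeFn_toLp] with x h1 h2
  rw [h1, h2]

/-! ### Continuous functionals on `H¹` -/

lemma tendsto_integral_inner {α : Type*} [MeasurableSpace α] {μ : Measure α} {A u : α → Plane}
    {w : ℕ → α → Plane} (hA : MemLp A 2 μ) (hw : ∀ n, MemLp (w n) 2 μ) (hu : MemLp u 2 μ)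
    (h : Tendsto (fun n => eLpNorm (fun x => w n x - u x) 2 μ) atTop (𝓝 0)) :
    Tendsto (fun n => ∫ x, inner ℝ (A x) (w n x) ∂μ) atTop (𝓝 (∫ x, inner ℝ (A x) (u x) ∂μ)) := by
  have key : ∀ v (hv : MemLp v 2 μ),
      inner ℝ (hA.toLp A) (hv.toLp v) = ∫ x, inner ℝ (A x) (v x) ∂μ := by
    intro v hv
    rw [L2.inner_def]
    apply integral_congr_ae
    filter_upwards [hA.coeFn_toLp, hv.coeFn_toLp] with x h1 h2
    rw [h1, h2]
  have h2 := (Lp.tendsto_Lp_iff_tendsto_eLpNorm'' w hw u hu).2 h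
  have h3 := (tendsto_const_nhds (x := hA.toLp A)).inner (𝕜 := ℝ) h2
  simpa only [key] using h3

/-- The functional `u ↦ ∫ A · u + ∑ᵢ ∫ Bᵢ · ∂ᵢu` on `H¹`. -/
noncomputable def h1Functional (R : ℝ) (A : Plane → Plane) (B : Fin 2 → Plane → Plane)
    (u : Plane → Plane) (Du : Fin 2 → Plane → Plane) : ℝ :=
  (∫ x in annulus R, inner ℝ (A x) (u x)) + ∑ i, ∫ x in annulus R, inner ℝ (B i x) (Du i x)

lemma continuous_fderiv_apply {E : Type*} [NormedAddCommGroup E] [NormedSpace ℝ E]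
    {w : Plane → E} (hw : ContDiff ℝ 1 w) (i : Fin 2) :
    Continuous fun x => fderiv ℝ w x (basisVec i) :=
  (hw.continuous_fderiv one_ne_zero).clm_apply continuous_const

/-- With `L²` coefficients, `h1Functional` passes to `H¹` limits of smooth fields. -/
lemma tendsto_h1Functional {R : ℝ} {A u : Plane → Plane} {B Du : Fin 2 → Plane → Plane}
    {w : ℕ → Plane → Plane} (hA : MemLp A 2 (annulusMeasure R))
    (hB : ∀ i, MemLp (B i) 2 (annulusMeasure R)) (hw : ∀ n, ContDiff ℝ (⊤ : ℕ∞) (w n))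
    (hu : IsH1 (annulus R) u Du) (h : TendstoH1 (annulus R) w u Du) :
    Tendsto (fun n => h1Functional R A B (w n) (fun i x => fderiv ℝ (w n) x (basisVec i))) atTop
      (𝓝 (h1Functional R A B u Du)) := by
  have hw1 : ∀ n, ContDiff ℝ 1 (w n) := fun n => (hw n).of_le (by exact_mod_cast le_top)
  refine (tendsto_integral_inner hA (fun n => memLp_of_continuousOn
    (hw n).continuous.continuousOn 2) hu.memLp h.1).add (tendsto_finsetSum _ fun i _ => ?_)
  exact tendsto_integral_inner (hB i) (fun n => memLp_of_continuousOn
    (continuous_fderiv_apply (hw1 n) i).continuousOn 2) (hu.memLp_deriv i) (h.2 i)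

/-! ### Integration of radial functions -/

lemma image_sq_Ioo {R : ℝ} (hR : 1 < R) : (fun r : ℝ => r ^ 2) '' Ioo 1 R = Ioo 1 (R ^ 2) := by
  ext s
  constructor
  · rintro ⟨r, ⟨h1, h2⟩, rfl⟩
    constructor <;> simp only <;> nlinarith
  · rintro ⟨h1, h2⟩
    refine ⟨√s, ⟨?_, ?_⟩, Real.sq_sqrt (by linarith)⟩
    · rw [Real.lt_sqrt (by norm_num)]; simpa using h1
    · rw [Real.sqrt_lt' (by linarith)]; exact h2

lemma indicator_annulus_radial (R : ℝ) (g : ℝ → ℝ) :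
    (annulus R).indicator (fun x : Plane => g (‖x‖ ^ 2)) =
      fun x => (Ioo 1 R).indicator (fun r => g (r ^ 2)) ‖x‖ := by
  ext x
  by_cases hx : x ∈ annulus R
  · rw [indicator_of_mem hx, indicator_of_mem (show ‖x‖ ∈ Ioo 1 R from mem_annulus.1 hx)]
  · rw [indicator_of_notMem hx,
      indicator_of_notMem (show ‖x‖ ∉ Ioo 1 R from fun h => hx (mem_annulus.2 h))]

lemma Ioi_indicator_Ioo (R : ℝ) (g : ℝ → ℝ) :
    (Ioi (0 : ℝ)).indicator (fun y => y ^ (2 - 1) • (Ioo 1 R).indicator (fun r => g (r ^ 2)) y) =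
      (Ioo 1 R).indicator (fun r => r * g (r ^ 2)) := by
  ext y
  by_cases hy : y ∈ Ioo 1 R
  · rw [indicator_of_mem hy, indicator_of_mem (show y ∈ Ioi (0 : ℝ) from lt_trans one_pos hy.1),
      indicator_of_mem hy]
    simp
  · rw [indicator_of_notMem hy, indicator_apply, indicator_of_notMem hy]
    simp

lemma integrableOn_radial_iff {R : ℝ} (hR : 1 < R) (g : ℝ → ℝ) :
    IntegrableOn (fun x : Plane => g (‖x‖ ^ 2)) (annulus R) ↔ IntegrableOn g (Ioo 1 (R ^ 2)) := by
  rw [← integrable_indicator_iff (measurableSet_annulus R), indicator_annulus_radial,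
    integrable_fun_norm_addHaar, ← integrable_indicator_iff measurableSet_Ioi,
    finrank_euclideanSpace, Fintype.card_fin, Ioi_indicator_Ioo,
    integrable_indicator_iff measurableSet_Ioo, ← image_sq_Ioo hR,
    integrableOn_image_iff_integrableOn_abs_deriv_smul measurableSet_Ioo (f' := fun r => 2 * r)
      (fun r _ => by simpa using ((hasDerivAt_pow 2 r).hasDerivWithinAt))
      (fun a ha b hb h => by
        have h1 := ha.1; have h2 := hb.1
        exact (pow_left_inj₀ (by linarith) (by linarith) two_ne_zero).1 h)]
  have : IntegrableOn (fun r => |2 * r| • g (r ^ 2)) (Ioo 1 R) ↔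
      IntegrableOn (fun r => 2 * (r * g (r ^ 2))) (Ioo 1 R) := by
    refine integrableOn_congr_fun (fun r hr => ?_) measurableSet_Ioo
    have := hr.1
    simp only [smul_eq_mul]
    rw [abs_of_pos (by linarith)]
    ring
  rw [this]
  constructor
  · intro h; exact h.const_mul 2
  · intro h; refine (h.const_mul (1 / 2)).congr (ae_of_all _ fun r => ?_); simp

lemma integral_radial {R : ℝ} (hR : 1 < R) (g : ℝ → ℝ) :
    ∫ x in annulus R, g (‖x‖ ^ 2) = Real.pi * ∫ s in Ioo 1 (R ^ 2), g s := by
  rw [← integral_indicator (measurableSet_annulus R), indicator_annulus_radial,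
    integral_fun_norm_addHaar, ← integral_indicator measurableSet_Ioi,
    finrank_euclideanSpace, Fintype.card_fin, Ioi_indicator_Ioo,
    integral_indicator measurableSet_Ioo, ← image_sq_Ioo hR,
    integral_image_eq_integral_abs_deriv_smul measurableSet_Ioo (f' := fun r => 2 * r)
      (fun r _ => by simpa using ((hasDerivAt_pow 2 r).hasDerivWithinAt))
      (fun a ha b hb h => by
        have h1 := ha.1; have h2 := hb.1
        exact (pow_left_inj₀ (by linarith) (by linarith) two_ne_zero).1 h)]
  have : ∫ r in Ioo 1 R, |2 * r| • g (r ^ 2) = ∫ r in Ioo 1 R, 2 * (r * g (r ^ 2)) := by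
    refine setIntegral_congr_fun measurableSet_Ioo (fun r hr => ?_)
    have := hr.1
    simp only [smul_eq_mul]
    rw [abs_of_pos (by linarith)]
    ring
  rw [this, integral_const_mul, Measure.real, EuclideanSpace.volume_ball_fin_two]
  simp only [ENNReal.ofReal_one, one_pow, one_mul, ENNReal.toReal_ofReal Real.pi_pos.le,
    smul_eq_mul, nsmul_eq_mul]
  push_cast
  ring

/-! ### Integration by parts against radial functions -/

/-- The partial derivatives of a differentiable field, in the form used for weak derivatives. -/
noncomputable def grad (w : Plane → Plane) : Fin 2 → Plane → Plane :=
  fun i x => fderiv ℝ w x (basisVec i)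

lemma continuous_grad {w : Plane → Plane} (hw : ContDiff ℝ 1 w) (i : Fin 2) :
    Continuous (grad w i) := continuous_fderiv_apply hw i

lemma continuous_divOf_grad {w : Plane → Plane} (hw : ContDiff ℝ 1 w) :
    Continuous (divOf (grad w)) := by
  unfold divOf
  have := continuous_grad hw
  fun_prop

lemma grad_eq_zero_of_notMem_tsupport {w : Plane → Plane} {x : Plane} (hx : x ∉ tsupport w)
    (i : Fin 2) : grad w i x = 0 := by
  have : fderiv ℝ w x = 0 := by
    by_contra h
    exact hx (support_fderiv_subset ℝ h)
  simp [grad, this]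

lemma fderiv_coord {w : Plane → Plane} {x : Plane} (hw : DifferentiableAt ℝ w x) (i j : Fin 2) :
    fderiv ℝ (fun y => w y j) x (basisVec i) = grad w i x j := by
  have h := (EuclideanSpace.proj (𝕜 := ℝ) j).hasFDerivAt.comp x hw.hasFDerivAt
  have h2 : HasFDerivAt (fun y => w y j)
      ((EuclideanSpace.proj (𝕜 := ℝ) j).comp (fderiv ℝ w x)) x := h
  rw [h2.fderiv]
  simp [grad]

lemma hasFDerivAt_norm_sq (x : Plane) :
    HasFDerivAt (fun y : Plane => ‖y‖ ^ 2) ((2 : ℝ) • innerSL ℝ x) x := by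
  have := (hasStrictFDerivAt_norm_sq x).hasFDerivAt
  refine this.congr_fderiv ?_
  ext v
  simp [two_mul]

/-- Primitives of continuous functions of `‖x‖²` are `C¹`. -/
lemma hasFDerivAt_primitive_norm_sq {G : ℝ → ℝ} (hG : Continuous G) (c : ℝ) (x : Plane) :
    HasFDerivAt (fun y : Plane => c + ∫ t in (1 : ℝ)..‖y‖ ^ 2, G t)
      (G (‖x‖ ^ 2) • ((2 : ℝ) • innerSL ℝ x)) x := by
  have h1 : HasDerivAt (fun s => c + ∫ t in (1 : ℝ)..s, G t) (G (‖x‖ ^ 2)) (‖x‖ ^ 2) :=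
    (hG.integral_hasStrictDerivAt 1 _).hasDerivAt.const_add c
  exact HasDerivAt.comp_hasFDerivAt (f := fun y : Plane => ‖y‖ ^ 2) x h1 (hasFDerivAt_norm_sq x)

section

variable {R : ℝ} {Y : Plane → Plane}

lemma integral_mul_divOf_of_continuous (hY : ContDiff ℝ 1 Y) (hc : HasCompactSupport Y)
    (hs : tsupport Y ⊆ annulus R) {G : ℝ → ℝ} (hG : Continuous G) (c : ℝ) :
    ∫ x in annulus R, (c + ∫ t in (1 : ℝ)..‖x‖ ^ 2, G t) * divOf (grad Y) x =
      -2 * ∫ x in annulus R, G (‖x‖ ^ 2) * inner ℝ x (Y x) := by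
  set H : Plane → ℝ := fun x => c + ∫ t in (1 : ℝ)..‖x‖ ^ 2, G t with hH
  have hYd := hY.differentiable one_ne_zero
  have hHd : ∀ x, HasFDerivAt H (G (‖x‖ ^ 2) • ((2 : ℝ) • innerSL ℝ x)) x :=
    hasFDerivAt_primitive_norm_sq hG c
  have hHc : Continuous H := continuous_iff_continuousAt.2 fun x => (hHd x).continuousAt
  have hgc := continuous_grad hY
  have hYc := hY.continuous
  have hYsupp : ∀ x, x ∉ tsupport Y → Y x = 0 := fun x => image_eq_zero_of_notMem_tsupport
  have hint : ∀ g : Plane → ℝ, Continuous g → (∀ x, x ∉ tsupport Y → g x = 0) → Integrable g :=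
    fun g h1 h2 => h1.integrable_of_hasCompactSupport (HasCompactSupport.intro hc h2)
  have hD : ∀ i, ∀ x, fderiv ℝ (fun y => Y y i) x (basisVec i) = grad Y i x i :=
    fun i x => fderiv_coord (hYd x) i i
  have hH' : ∀ i x, fderiv ℝ H x (basisVec i) = 2 * x i * G (‖x‖ ^ 2) := by
    intro i x
    rw [(hHd x).fderiv]
    fin_cases i <;> simp [inner_eq] <;> ring
  have key : ∀ i, ∫ x, H x * grad Y i x i = - ∫ x, 2 * x i * G (‖x‖ ^ 2) * Y x i := by
    intro i
    have hYi : Differentiable ℝ (fun y => Y y i) := by fun_prop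
    have := integral_mul_fderiv_eq_neg_fderiv_mul_of_integrable (μ := (volume : Measure Plane))
      (f := H) (g := fun y => Y y i) (v := basisVec i) ?_ ?_ ?_
      (fun x _ => (hHd x).differentiableAt) (fun x _ => hYi x)
    · simpa only [hD, hH'] using this
    · simp only [hH']
      exact hint _ (by fun_prop) fun x hx => by simp [hYsupp x hx]
    · simp only [hD]
      exact hint _ (by fun_prop) fun x hx => by simp [grad_eq_zero_of_notMem_tsupport hx]
    · exact hint _ (by fun_prop) fun x hx => by simp [hYsupp x hx]
  rw [setIntegral_eq_integral_of_forall_compl_eq_zero,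
    setIntegral_eq_integral_of_forall_compl_eq_zero]
  · have h1 : ∫ x, H x * divOf (grad Y) x =
        (∫ x, H x * grad Y 0 x 0) + ∫ x, H x * grad Y 1 x 1 := by
      rw [← integral_add]
      · simp only [divOf, Fin.sum_univ_two, mul_add]
      all_goals
        exact hint _ (by fun_prop) fun x hx => by simp [grad_eq_zero_of_notMem_tsupport hx]
    rw [h1, key, key, ← integral_const_mul, ← neg_add, ← integral_add, ← integral_neg]
    · refine integral_congr_ae (ae_of_all _ fun x => ?_)
      simp only [inner_eq]
      ring
    all_goals
      exact hint _ (by fun_prop) fun x hx => by simp [hYsupp x hx]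
  · intro x hx
    simp [hYsupp x fun h => hx (hs h)]
  · intro x hx
    simp [divOf, grad_eq_zero_of_notMem_tsupport fun h => hx (hs h)]

/-- Integration by parts of a divergence against a radial function `H(‖x‖²)`, for `H` absolutely
continuous with derivative `G`. -/
lemma integral_mul_divOf (hR : 1 < R) (hY : ContDiff ℝ 1 Y) (hc : HasCompactSupport Y)
    (hs : tsupport Y ⊆ annulus R) {G : ℝ → ℝ} (hG : Integrable G) (c : ℝ) :
    ∫ x in annulus R, (c + ∫ t in (1 : ℝ)..‖x‖ ^ 2, G t) * divOf (grad Y) x =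
      -2 * ∫ x in annulus R, G (‖x‖ ^ 2) * inner ℝ x (Y x) := by
  have hYc := hY.continuous
  have hdc := continuous_divOf_grad hY
  have hic : Continuous fun x => inner ℝ x (Y x) := by fun_prop
  obtain ⟨D, hD⟩ := (isCompact_closedAnnulus R).exists_bound_of_continuousOn hdc.continuousOn
  obtain ⟨D', hD'⟩ := (isCompact_closedAnnulus R).exists_bound_of_continuousOn hic.continuousOn
  have hsub := annulus_subset_closedAnnulus R
  -- both sides are Lipschitz in `G` for the `L¹` norm, and continuous functions are dense
  set C := D * volume.real (annulus R) + 2 * (D' * Real.pi) with hC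
  have hD'0 : 0 ≤ D' := by
    refine (norm_nonneg _).trans (hD' (!₂[1, 0]) (mem_closedAnnulus.2 ?_))
    have : ‖(!₂[1, 0] : Plane)‖ = 1 := by simp [EuclideanSpace.norm_eq]
    rw [this]; exact ⟨le_rfl, hR.le⟩
  have hiH : ∀ g : ℝ → ℝ, Integrable g → IntegrableOn
      (fun x : Plane => (c + ∫ t in (1 : ℝ)..‖x‖ ^ 2, g t) * divOf (grad Y) x) (annulus R) := by
    intro g hg
    have h1 : Continuous fun s => ∫ t in (1 : ℝ)..s, g t :=
      intervalIntegral.continuous_primitive (fun a b => hg.intervalIntegrable) 1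
    have h2 : Continuous fun x : Plane => (c + ∫ t in (1 : ℝ)..‖x‖ ^ 2, g t) * divOf (grad Y) x :=
      (continuous_const.add (h1.comp (by fun_prop))).mul hdc
    exact memLp_one_iff_integrable.1 (memLp_of_continuousOn h2.continuousOn 1)
  have hrad : ∀ g : ℝ → ℝ, Integrable g → IntegrableOn (fun x : Plane => g (‖x‖ ^ 2)) (annulus R) :=
    fun g hg => (integrableOn_radial_iff hR g).2 hg.integrableOn
  have hiG : ∀ g : ℝ → ℝ, Integrable g → IntegrableOn
      (fun x : Plane => g (‖x‖ ^ 2) * inner ℝ x (Y x)) (annulus R) := by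
    intro g hg
    refine (hrad g hg).mul_bdd (c := D') hic.aestronglyMeasurable ?_
    filter_upwards [ae_restrict_mem (measurableSet_annulus R)] with x hx
    exact hD' x (hsub hx)
  refine eq_of_abs_sub_nonpos (le_of_forall_pos_le_add fun ε hε => ?_)
  have hC0 : 0 ≤ |C| := abs_nonneg _
  obtain ⟨g, -, hgε, hgc, hgi⟩ := hG.exists_hasCompactSupport_integral_sub_le
    (ε := ε / (|C| + 1)) (by positivity)
  set δ := ε / (|C| + 1)
  have hδ0 : 0 < δ := by positivity
  have e0 := integral_mul_divOf_of_continuous hY hc hs hgc c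
  have e1 : |(∫ x in annulus R, (c + ∫ t in (1 : ℝ)..‖x‖ ^ 2, G t) * divOf (grad Y) x) -
      ∫ x in annulus R, (c + ∫ t in (1 : ℝ)..‖x‖ ^ 2, g t) * divOf (grad Y) x| ≤
      δ * D * volume.real (annulus R) := by
    rw [← integral_sub (hiH G hG) (hiH g hgi), ← Real.norm_eq_abs]
    refine norm_setIntegral_le_of_norm_le_const
      ((measure_mono sdiff_subset).trans_lt measure_ball_lt_top) fun x hx => ?_
    rw [← sub_mul, add_sub_add_left_eq_sub, norm_mul, ← intervalIntegral.integral_sub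
      hG.intervalIntegrable hgi.intervalIntegrable]
    refine mul_le_mul ?_ (hD x (hsub hx)) (norm_nonneg _) hδ0.le
    refine (intervalIntegral.norm_integral_le_integral_norm_uIoc).trans (le_trans ?_ hgε)
    exact setIntegral_le_integral (hG.sub hgi).norm (ae_of_all _ fun t => norm_nonneg _)
  have e2 : |(∫ x in annulus R, G (‖x‖ ^ 2) * inner ℝ x (Y x)) -
      ∫ x in annulus R, g (‖x‖ ^ 2) * inner ℝ x (Y x)| ≤ δ * D' * Real.pi := by
    rw [← integral_sub (hiG G hG) (hiG g hgi), ← Real.norm_eq_abs]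
    have hr := integral_radial hR (fun s => ‖G s - g s‖)
    have h3 : ∫ s in Ioo 1 (R ^ 2), ‖G s - g s‖ ≤ δ :=
      le_trans (setIntegral_le_integral (hG.sub hgi).norm (ae_of_all _ fun t => norm_nonneg _)) hgε
    calc _ ≤ ∫ x in annulus R, D' * ‖G (‖x‖ ^ 2) - g (‖x‖ ^ 2)‖ := by
          refine norm_integral_le_of_norm_le ((hrad _ (hG.sub hgi).norm).const_mul D') ?_
          filter_upwards [ae_restrict_mem (measurableSet_annulus R)] with x hx
          rw [← sub_mul, norm_mul, mul_comm]
          exact mul_le_mul_of_nonneg_right (hD' x (hsub hx)) (norm_nonneg _)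
      _ = D' * (Real.pi * ∫ s in Ioo 1 (R ^ 2), ‖G s - g s‖) := by rw [integral_const_mul, hr]
      _ ≤ D' * (Real.pi * δ) := by gcongr
      _ = _ := by ring
  have e3 : δ * C ≤ ε := by
    calc δ * C ≤ δ * (|C| + 1) := by gcongr; linarith [le_abs_self C]
      _ = ε := by simp only [δ]; field_simp
  rw [abs_le] at e1 e2
  rw [zero_add, abs_le]
  have e4 : δ * C = δ * D * volume.real (annulus R) + 2 * (δ * D' * Real.pi) := by
    rw [hC]; ring
  constructor <;> linarith [e1.1, e1.2, e2.1, e2.2]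

end

/-! ### Swirling fields -/

/-- The swirling field `V(‖x‖²) x^⊥`, where `V` is the primitive of `B` with `V(1) = 0`, which makes
it vanish on the unit circle. The term `0 +` matches primitives with a general constant. -/
noncomputable def swirl (B : ℝ → ℝ) (x : Plane) : Plane :=
  (0 + ∫ t in (1 : ℝ)..‖x‖ ^ 2, B t) • perp x

lemma hasFDerivAt_swirl {B : ℝ → ℝ} (hB : Continuous B) (x : Plane) :
    HasFDerivAt (swirl B) ((0 + ∫ t in (1 : ℝ)..‖x‖ ^ 2, B t) • perp +
      (B (‖x‖ ^ 2) • ((2 : ℝ) • innerSL ℝ x)).smulRight (perp x)) x :=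
  (hasFDerivAt_primitive_norm_sq hB 0 x).smul perp.hasFDerivAt

lemma grad_swirl {B : ℝ → ℝ} (hB : Continuous B) (i : Fin 2) (x : Plane) :
    grad (swirl B) i x = (0 + ∫ t in (1 : ℝ)..‖x‖ ^ 2, B t) • perp (basisVec i) +
      (2 * x i * B (‖x‖ ^ 2)) • perp x := by
  rw [grad, (hasFDerivAt_swirl hB x).fderiv]
  have : inner ℝ x (basisVec i) = x i := by fin_cases i <;> simp [inner_eq]
  simp [this]
  ring_nf

lemma continuous_primitive_norm_sq {B : ℝ → ℝ} (hB : Continuous B) :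
    Continuous fun x : Plane => 0 + ∫ t in (1 : ℝ)..‖x‖ ^ 2, B t :=
  continuous_iff_continuousAt.2 fun x => (hasFDerivAt_primitive_norm_sq hB 0 x).continuousAt

lemma continuous_swirl {B : ℝ → ℝ} (hB : Continuous B) : Continuous (swirl B) :=
  (continuous_primitive_norm_sq hB).smul perp.continuous

lemma continuous_grad_swirl {B : ℝ → ℝ} (hB : Continuous B) (i : Fin 2) :
    Continuous (grad (swirl B) i) := by
  have : grad (swirl B) i = fun x => (0 + ∫ t in (1 : ℝ)..‖x‖ ^ 2, B t) • perp (basisVec i) +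
      (2 * x i * B (‖x‖ ^ 2)) • perp x := funext fun x => grad_swirl hB i x
  rw [this]
  have := continuous_primitive_norm_sq hB
  fun_prop

lemma divOf_grad_swirl {B : ℝ → ℝ} (hB : Continuous B) (x : Plane) :
    divOf (grad (swirl B)) x = 0 := by
  simp only [divOf, Fin.sum_univ_two, grad_swirl hB]
  simp
  ring

/-- The convective term of a swirling field is radial, the centripetal acceleration. -/
lemma convective_swirl {B : ℝ → ℝ} (hB : Continuous B) (x : Plane) :
    convective (swirl B) (grad (swirl B)) x = -((∫ t in (1 : ℝ)..‖x‖ ^ 2, B t) ^ 2 • x) := by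
  ext j
  simp only [convective, Fin.sum_univ_two, grad_swirl hB, swirl]
  fin_cases j <;> simp <;> ring

lemma contDiff_one_of_smooth {w : Plane → Plane} (hw : ContDiff ℝ (⊤ : ℕ∞) w) : ContDiff ℝ 1 w :=
  hw.of_le (by exact_mod_cast le_top)

section

variable {R : ℝ} {w : Plane → Plane}

/-- The field `(x^⊥ · w) x / ‖x‖⁴`; testing a radial function against its divergence
extracts the angular component of `w`. -/
noncomputable def angularFlux (w : Plane → Plane) (x : Plane) : Plane :=
  (inner ℝ (perp x) (w x) / (‖x‖ ^ 2) ^ 2) • x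

lemma tsupport_angularFlux_subset : tsupport (angularFlux w) ⊆ tsupport w := by
  refine closure_mono fun x hx => ?_
  contrapose! hx
  simp only [Function.mem_support, not_not] at hx ⊢
  simp [angularFlux, hx]

lemma contDiff_angularFlux (hw : ContDiff ℝ 1 w) (hs : tsupport w ⊆ annulus R) :
    ContDiff ℝ 1 (angularFlux w) := by
  refine contDiff_iff_contDiffAt.2 fun x => ?_
  by_cases hx : x ∈ tsupport w
  · have hx0 := norm_ne_zero_of_mem (annulus_subset_closedAnnulus R (hs hx))
    have h1 : ContDiffAt ℝ 1 (fun y : Plane => ‖y‖ ^ 2) x := (contDiff_norm_sq ℝ).contDiffAt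
    have h2 : ContDiffAt ℝ 1 (fun y : Plane => inner ℝ (perp y) (w y)) x :=
      (perp.contDiff.inner ℝ hw).contDiffAt
    exact (h2.div (h1.pow 2) (by positivity)).smul contDiffAt_id
  · have h1 : angularFlux w =ᶠ[𝓝 x] fun _ => 0 := by
      have : tsupport (angularFlux w) ⊆ tsupport w := tsupport_angularFlux_subset
      exact notMem_tsupport_iff_eventuallyEq.1 fun h => hx (this h)
    exact contDiffAt_const.congr_of_eventuallyEq h1

lemma divOf_grad_angularFlux (hw : ContDiff ℝ 1 w) {x : Plane} (hx : x ∈ annulus R) :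
    (‖x‖ ^ 2) ^ 2 * divOf (grad (angularFlux w)) x =
      x 0 * inner ℝ (perp x) (grad w 0 x) + x 1 * inner ℝ (perp x) (grad w 1 x) -
        inner ℝ (perp x) (w x) := by
  have hx0 := norm_ne_zero_of_mem (annulus_subset_closedAnnulus R hx)
  have hwd := (hw.differentiable one_ne_zero x).hasFDerivAt
  have h1 := perp.hasFDerivAt.inner ℝ hwd
  have hp : HasDerivAt (fun s : ℝ => (s ^ 2)⁻¹)
      (-(2 * ‖x‖ ^ 2) / ((‖x‖ ^ 2) ^ 2) ^ 2) (‖x‖ ^ 2) := by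
    exact ((hasDerivAt_pow 2 (‖x‖ ^ 2)).fun_inv (by positivity)).congr_deriv (by simp)
  have h2 := HasDerivAt.comp_hasFDerivAt (f := fun y : Plane => ‖y‖ ^ 2) x hp
    (hasFDerivAt_norm_sq x)
  have h4 : HasFDerivAt (angularFlux w) _ x := (h1.mul h2).smul (hasFDerivAt_id x)
  have hn := norm_sq_eq x
  simp only [divOf, Fin.sum_univ_two, grad, h4.fderiv]
  simp [inner_eq, fderivInnerCLM_apply]
  field_simp
  rw [hn]
  ring

/-- The weak form of `-Δ(V(‖x‖²) x^⊥) = -(4 / s) (s² V')' x^⊥`, `s = ‖x‖²`, where `B = V'` and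
`s² B` is absolutely continuous with derivative `G`. With `m = x^⊥ · w`, the product `∇u · ∇w` is
`2 s² B div(m x / s²) + V div(-w^⊥) + 2 B m`, and the last two terms together integrate to zero. -/
lemma integral_gradProd_swirl (hR : 1 < R) (hw : ContDiff ℝ (⊤ : ℕ∞) w) (hc : HasCompactSupport w)
    (hs : tsupport w ⊆ annulus R) {B G : ℝ → ℝ} (hB : Continuous B) (hG : Integrable G) (c : ℝ)
    (hBG : ∀ s ∈ Icc 1 (R ^ 2), s ^ 2 * B s = c + ∫ t in (1 : ℝ)..s, G t) :
    ∫ x in annulus R, gradProd (grad (swirl B)) (grad w) x =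
      -4 * ∫ x in annulus R, G (‖x‖ ^ 2) * (inner ℝ (perp x) (w x) / ‖x‖ ^ 2) := by
  have hw1 := contDiff_one_of_smooth hw
  have hsub := annulus_subset_closedAnnulus R
  have hY1 : ContDiff ℝ 1 fun x => -perp (w x) := (perp.contDiff.comp hw1).neg
  have hs1 : tsupport (fun x => -perp (w x)) ⊆ tsupport w := by
    refine closure_mono fun x hx => ?_
    contrapose! hx
    simp only [Function.mem_support, not_not] at hx ⊢
    simp [hx]
  have hY2 := contDiff_angularFlux hw1 hs
  have hc1 : HasCompactSupport fun x => -perp (w x) := hc.mono' (subset_closure.trans hs1)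
  have hc2 : HasCompactSupport (angularFlux w) :=
    hc.mono' (subset_closure.trans tsupport_angularFlux_subset)
  have e1 := integral_mul_divOf_of_continuous hY1 hc1 (hs1.trans hs) hB 0
  have e2 := integral_mul_divOf hR hY2 hc2 (tsupport_angularFlux_subset.trans hs) hG c
  have hd1 : ∀ x, divOf (grad fun x => -perp (w x)) x = grad w 0 x 1 - grad w 1 x 0 := by
    intro x
    have h := (perp.hasFDerivAt.comp x (hw1.differentiable one_ne_zero x).hasFDerivAt).neg
    have h' : HasFDerivAt (fun x => -perp (w x)) _ x := h
    simp only [divOf, Fin.sum_univ_two, grad, h'.fderiv]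
    simp
    ring
  have hpt : ∀ x ∈ annulus R, gradProd (grad (swirl B)) (grad w) x =
      2 * ((c + ∫ t in (1 : ℝ)..‖x‖ ^ 2, G t) * divOf (grad (angularFlux w)) x) +
      (2 * (B (‖x‖ ^ 2) * inner ℝ x (-perp (w x))) +
        (0 + ∫ t in (1 : ℝ)..‖x‖ ^ 2, B t) * divOf (grad fun x => -perp (w x)) x) := by
    intro x hx
    rw [← hBG _ (norm_sq_mem_Icc (hsub hx)), mul_right_comm, divOf_grad_angularFlux hw1 hx, hd1]
    simp only [gradProd, Fin.sum_univ_two, grad_swirl hB, inner_eq]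
    simp
    ring
  have hcw := hw1.continuous
  have i1 : IntegrableOn (fun x : Plane => 2 * ((c + ∫ t in (1 : ℝ)..‖x‖ ^ 2, G t) *
      divOf (grad (angularFlux w)) x)) (annulus R) := by
    have h1 : Continuous fun s => ∫ t in (1 : ℝ)..s, G t :=
      intervalIntegral.continuous_primitive (fun a b => hG.intervalIntegrable) 1
    have h2 := continuous_divOf_grad hY2
    have h3 : Continuous fun x : Plane => ∫ t in (1 : ℝ)..‖x‖ ^ 2, G t := h1.comp (by fun_prop)
    exact memLp_one_iff_integrable.1
      (memLp_of_continuousOn (Continuous.continuousOn (by fun_prop)) 1)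
  have i2 : IntegrableOn (fun x : Plane => 2 * (B (‖x‖ ^ 2) * inner ℝ x (-perp (w x))))
      (annulus R) :=
    memLp_one_iff_integrable.1 (memLp_of_continuousOn (Continuous.continuousOn (by fun_prop)) 1)
  have i3 : IntegrableOn (fun x : Plane => (0 + ∫ t in (1 : ℝ)..‖x‖ ^ 2, B t) *
      divOf (grad fun x => -perp (w x)) x) (annulus R) := by
    have h2 := continuous_divOf_grad hY1
    have h3 := continuous_primitive_norm_sq hB
    exact memLp_one_iff_integrable.1 (memLp_of_continuousOn (h3.mul h2).continuousOn 1)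
  have e3 := integral_add i1 (i2.add i3)
  have e4 := integral_add i2 i3
  simp only [Pi.add_apply] at e3
  rw [setIntegral_congr_fun (measurableSet_annulus R) hpt, e3, e4, integral_const_mul,
    integral_const_mul, e1, e2]
  have : ∀ x ∈ annulus R, G (‖x‖ ^ 2) * inner ℝ x (angularFlux w x) =
      G (‖x‖ ^ 2) * (inner ℝ (perp x) (w x) / ‖x‖ ^ 2) := by
    intro x hx
    have hx0 := norm_ne_zero_of_mem (hsub hx)
    rw [angularFlux, real_inner_smul_right, real_inner_self_eq_norm_sq]
    field_simp
  rw [setIntegral_congr_fun (measurableSet_annulus R) this]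
  ring

end

/-! ### Polar coordinates and the flux across the cut -/

lemma norm_circlePath {r : ℝ} (hr : 0 ≤ r) (t : ℝ) : ‖circlePath r t‖ = r := by
  have : ‖circlePath r t‖ ^ 2 = r ^ 2 := by
    rw [norm_sq_eq]
    simp [circlePath]
    linear_combination r ^ 2 * Real.cos_sq_add_sin_sq t
  exact (pow_left_inj₀ (norm_nonneg _) hr two_ne_zero).1 this

lemma integral_annulus_polar (R : ℝ) (g : Plane → ℝ) :
    ∫ x in annulus R, g x =
      ∫ p in Ioo 1 R ×ˢ Ioo (-Real.pi) Real.pi, p.1 * g (circlePath p.1 p.2) := by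
  set e : ℝ × ℝ ≃ᵐ Plane :=
    MeasurableEquiv.finTwoArrow.symm.trans (MeasurableEquiv.toLp 2 (Fin 2 → ℝ)) with he
  have hmp : MeasurePreserving e volume volume :=
    (PiLp.volume_preserving_toLp (Fin 2)).comp ((volume_preserving_finTwoArrow ℝ).symm _)
  have hcp : ∀ p : ℝ × ℝ, e (polarCoord.symm p) = circlePath p.1 p.2 := by
    intro p
    ext i
    fin_cases i <;> simp [he, circlePath, polarCoord_symm_apply]
  rw [← integral_indicator (measurableSet_annulus R), ← hmp.integral_comp',
    ← integral_comp_polarCoord_symm]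
  have h1 : ∀ p ∈ polarCoord.target, p.1 • (annulus R).indicator g (e (polarCoord.symm p)) =
      (Ioo 1 R ×ˢ univ).indicator (fun p : ℝ × ℝ => p.1 * g (circlePath p.1 p.2)) p := by
    intro p hp
    have hp0 : 0 < p.1 := hp.1
    rw [hcp]
    by_cases h : p.1 ∈ Ioo 1 R
    · rw [indicator_of_mem (show circlePath p.1 p.2 ∈ annulus R by
        rw [mem_annulus, norm_circlePath hp0.le]; exact h),
        indicator_of_mem (show p ∈ Ioo 1 R ×ˢ univ from ⟨h, mem_univ _⟩), smul_eq_mul]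
    · rw [indicator_of_notMem (show circlePath p.1 p.2 ∉ annulus R by
        rw [mem_annulus, norm_circlePath hp0.le]; exact h),
        indicator_of_notMem (show p ∉ Ioo 1 R ×ˢ univ from fun h' => h h'.1), smul_zero]
  rw [setIntegral_congr_fun polarCoord.open_target.measurableSet h1,
    setIntegral_indicator (measurableSet_Ioo.prod MeasurableSet.univ)]
  congr 2
  ext p
  simp only [polarCoord_target, mem_inter_iff, mem_prod, mem_Ioi, mem_univ, and_true]
  constructor
  · rintro ⟨⟨-, h1⟩, h2⟩; exact ⟨h2, h1⟩
  · rintro ⟨h1, h2⟩; exact ⟨⟨lt_trans one_pos h1.1, h2⟩, h1⟩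

/-- The `2π`-periodic sawtooth on `(-π, π)`, which jumps by `2π` at `0`: up to sign a primitive
of `1 - 2π δ₀` on the circle. -/
noncomputable def sawtooth (t : ℝ) : ℝ := if 0 < t then Real.pi - t else -Real.pi - t

lemma measurable_sawtooth : Measurable sawtooth :=
  Measurable.ite measurableSet_Ioi (by fun_prop) (by fun_prop)

lemma abs_sawtooth_le {t : ℝ} (ht : t ∈ Icc (-Real.pi) Real.pi) : |sawtooth t| ≤ Real.pi := by
  have := ht.1; have := ht.2
  unfold sawtooth
  split_ifs <;> rw [abs_le] <;> constructor <;> linarith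

/-- Integration by parts against the sawtooth recovers the value at `0` from the mean and the
derivative. -/
lemma integral_sub_sawtooth_mul {g g' : ℝ → ℝ} (hg : ∀ t, HasDerivAt g (g' t) t)
    (hg' : Continuous g') :
    ∫ t in Ioo (-Real.pi) Real.pi, (g t - sawtooth t * g' t) = 2 * Real.pi * g 0 := by
  have hpi := Real.pi_pos
  have hgc : Continuous g := continuous_iff_continuousAt.2 fun t => (hg t).continuousAt
  have h1 : ∀ a b c : ℝ, ∫ t in a..b, (g t - (c - t) * g' t) =
      -(c - b) * g b + (c - a) * g a := by
    intro a b c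
    have hd : ∀ t ∈ uIcc a b, HasDerivAt (fun t => -(c - t) * g t) (g t - (c - t) * g' t) t := by
      intro t _
      have := (((hasDerivAt_id t).const_sub c).neg.mul (hg t))
      refine this.congr_deriv ?_
      simp
      ring
    rw [intervalIntegral.integral_eq_sub_of_hasDerivAt hd
      (Continuous.intervalIntegrable (by fun_prop) _ _)]
    ring
  have e1 : EqOn (fun t => g t - sawtooth t * g' t) (fun t => g t - (-Real.pi - t) * g' t)
      (Ioc (-Real.pi) 0) := fun t ht => by
    simp only [sawtooth, if_neg (not_lt.2 ht.2)]
  have e2 : EqOn (fun t => g t - sawtooth t * g' t) (fun t => g t - (Real.pi - t) * g' t)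
      (Ioc 0 Real.pi) := fun t ht => by
    simp only [sawtooth, if_pos ht.1]
  have i1 : IntervalIntegrable (fun t => g t - sawtooth t * g' t) volume (-Real.pi) 0 := by
    refine (Continuous.intervalIntegrable (u := fun t => g t - (-Real.pi - t) * g' t)
      (by fun_prop) _ _).congr ?_
    rw [uIoc_of_le (by linarith)]
    exact e1.symm
  have i2 : IntervalIntegrable (fun t => g t - sawtooth t * g' t) volume 0 Real.pi := by
    refine (Continuous.intervalIntegrable (u := fun t => g t - (Real.pi - t) * g' t)
      (by fun_prop) _ _).congr ?_
    rw [uIoc_of_le hpi.le]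
    exact e2.symm
  rw [← integral_Ioc_eq_integral_Ioo, ← intervalIntegral.integral_of_le (by linarith),
    ← intervalIntegral.integral_add_adjacent_intervals i1 i2,
    intervalIntegral.integral_congr_ae (g := fun t => g t - (-Real.pi - t) * g' t)
      (ae_of_all _ fun t ht => e1 (by rwa [uIoc_of_le (by linarith)] at ht)),
    intervalIntegral.integral_congr_ae (g := fun t => g t - (Real.pi - t) * g' t)
      (ae_of_all _ fun t ht => e2 (by rwa [uIoc_of_le hpi.le] at ht)), h1, h1]
  ring

/-- The sawtooth of the polar angle, as a function on the plane. -/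
noncomputable def angleWeight (x : Plane) : ℝ := sawtooth (Complex.arg ⟨x 0, x 1⟩)

lemma measurable_angleWeight : Measurable angleWeight := by
  have h : Continuous fun x : Plane => (⟨x 0, x 1⟩ : ℂ) := by
    have : (fun x : Plane => (⟨x 0, x 1⟩ : ℂ)) =
        fun x : Plane => (x 0 : ℂ) + (x 1 : ℂ) * Complex.I := by
      ext x
      exact Complex.mk_eq_add_mul_I _ _
    rw [this]
    fun_prop
  exact measurable_sawtooth.comp (Complex.measurable_arg.comp h.measurable)

lemma abs_angleWeight_le (x : Plane) : |angleWeight x| ≤ Real.pi :=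
  abs_sawtooth_le ⟨(Complex.neg_pi_lt_arg _).le, Complex.arg_le_pi _⟩

lemma angleWeight_circlePath {r t : ℝ} (hr : 0 < r) (ht : t ∈ Ioo (-Real.pi) Real.pi) :
    angleWeight (circlePath r t) = sawtooth t := by
  have h : (⟨circlePath r t 0, circlePath r t 1⟩ : ℂ) =
      r * (Complex.cos t + Complex.sin t * Complex.I) := by
    apply Complex.ext <;> simp [circlePath, Complex.cos_ofReal_re, Complex.sin_ofReal_re]
  rw [angleWeight, h, Complex.arg_mul_cos_add_sin_mul_I hr ⟨ht.1, ht.2.le⟩]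

section

variable {R : ℝ}

lemma integrableOn_box {F : ℝ × ℝ → ℝ}
    (hF : ContinuousOn F (Icc 1 R ×ˢ Icc (-Real.pi) Real.pi)) :
    IntegrableOn F (Ioo 1 R ×ˢ Ioo (-Real.pi) Real.pi) :=
  (hF.integrableOn_compact (isCompact_Icc.prod isCompact_Icc)).mono_set
    (prod_mono Ioo_subset_Icc_self Ioo_subset_Icc_self)

lemma integrableOn_box_sawtooth {F : ℝ × ℝ → ℝ}
    (hF : ContinuousOn F (Icc 1 R ×ˢ Icc (-Real.pi) Real.pi)) :
    IntegrableOn (fun p => sawtooth p.2 * F p) (Ioo 1 R ×ˢ Ioo (-Real.pi) Real.pi) := by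
  refine (integrableOn_box hF).bdd_mul (c := Real.pi)
    (measurable_sawtooth.comp measurable_snd).aestronglyMeasurable ?_
  filter_upwards [ae_restrict_mem (measurableSet_Ioo.prod measurableSet_Ioo)] with p hp
  exact abs_sawtooth_le (Ioo_subset_Icc_self hp.2)

lemma continuous_circlePath : Continuous fun p : ℝ × ℝ => circlePath p.1 p.2 := by
  unfold circlePath
  refine (PiLp.continuous_toLp 2 _).comp (continuous_pi fun i => ?_)
  fin_cases i
  · exact continuous_fst.mul (Real.continuous_cos.comp continuous_snd)
  · exact continuous_fst.mul (Real.continuous_sin.comp continuous_snd)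

lemma continuous_cutPath : Continuous cutPath := by
  unfold cutPath
  refine (PiLp.continuous_toLp 2 _).comp (continuous_pi fun i => ?_)
  fin_cases i
  · exact continuous_id
  · exact continuous_const

lemma hasDerivAt_circlePath_angle (r t : ℝ) :
    HasDerivAt (circlePath r) (perp (circlePath r t)) t := by
  refine (PiLp.continuousLinearEquiv 2 ℝ fun _ : Fin 2 => ℝ).symm.hasFDerivAt.comp_hasDerivAt _
    (hasDerivAt_pi.2 ?_)
  intro i
  fin_cases i
  · simpa [circlePath] using (Real.hasDerivAt_cos t).const_mul r
  · simpa [circlePath] using (Real.hasDerivAt_sin t).const_mul r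

lemma hasDerivAt_circlePath_radius (r t : ℝ) :
    HasDerivAt (fun r => circlePath r t) (circlePath 1 t) r := by
  refine (PiLp.continuousLinearEquiv 2 ℝ fun _ : Fin 2 => ℝ).symm.hasFDerivAt.comp_hasDerivAt _
    (hasDerivAt_pi.2 ?_)
  intro i
  fin_cases i
  · simpa [circlePath] using (hasDerivAt_id r).mul_const (Real.cos t)
  · simpa [circlePath] using (hasDerivAt_id r).mul_const (Real.sin t)

variable {m : Plane → ℝ}

/-- The restriction of `m` to the cut, from bulk integrals of `m` and its angular derivative. -/
lemma integral_sub_angleWeight_mul (hm : ContDiff ℝ 1 m) :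
    ∫ x in annulus R, (m x - angleWeight x * fderiv ℝ m x (perp x)) / ‖x‖ ^ 2 =
      2 * Real.pi * ∫ r in Ioo 1 R, r⁻¹ * m (circlePath r 0) := by
  have hmd := hm.differentiable one_ne_zero
  have hmc := hm.continuous
  have hfc := hm.continuous_fderiv one_ne_zero
  have hcp := continuous_circlePath
  rw [integral_annulus_polar]
  have h1 : ∀ p ∈ Ioo 1 R ×ˢ Ioo (-Real.pi) Real.pi,
      p.1 * ((m (circlePath p.1 p.2) - angleWeight (circlePath p.1 p.2) *
        fderiv ℝ m (circlePath p.1 p.2) (perp (circlePath p.1 p.2))) / ‖circlePath p.1 p.2‖ ^ 2) =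
      p.1⁻¹ * m (circlePath p.1 p.2) - sawtooth p.2 *
        (p.1⁻¹ * fderiv ℝ m (circlePath p.1 p.2) (perp (circlePath p.1 p.2))) := by
    rintro p ⟨hp1, hp2⟩
    have hp0 : 0 < p.1 := lt_trans one_pos hp1.1
    rw [angleWeight_circlePath hp0 hp2, norm_circlePath hp0.le]
    field_simp
  have hinv : ContinuousOn (fun p : ℝ × ℝ => p.1⁻¹) (Icc 1 R ×ˢ Icc (-Real.pi) Real.pi) :=
    continuousOn_fst.inv₀ fun p hp => (lt_of_lt_of_le one_pos hp.1.1).ne'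
  have i1 : IntegrableOn (fun p : ℝ × ℝ => p.1⁻¹ * m (circlePath p.1 p.2))
      (Ioo 1 R ×ˢ Ioo (-Real.pi) Real.pi) :=
    integrableOn_box (hinv.mul (hmc.comp hcp).continuousOn)
  have i2 : IntegrableOn (fun p : ℝ × ℝ => sawtooth p.2 *
        (p.1⁻¹ * fderiv ℝ m (circlePath p.1 p.2) (perp (circlePath p.1 p.2))))
      (Ioo 1 R ×ˢ Ioo (-Real.pi) Real.pi) :=
    integrableOn_box_sawtooth (hinv.mul (Continuous.continuousOn
      ((hfc.comp hcp).clm_apply (perp.continuous.comp hcp))))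
  rw [setIntegral_congr_fun (measurableSet_Ioo.prod measurableSet_Ioo) h1]
  have i3 : IntegrableOn (fun p : ℝ × ℝ => p.1⁻¹ * m (circlePath p.1 p.2) - sawtooth p.2 *
        (p.1⁻¹ * fderiv ℝ m (circlePath p.1 p.2) (perp (circlePath p.1 p.2))))
      (Ioo 1 R ×ˢ Ioo (-Real.pi) Real.pi) := i1.sub i2
  rw [Measure.volume_eq_prod, setIntegral_prod _ i3, ← integral_const_mul]
  refine setIntegral_congr_fun measurableSet_Ioo fun r hr => ?_
  have hd : ∀ t, HasDerivAt (fun t => m (circlePath r t))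
      (fderiv ℝ m (circlePath r t) (perp (circlePath r t))) t := fun t =>
    (hmd (circlePath r t)).hasFDerivAt.comp_hasDerivAt t (hasDerivAt_circlePath_angle r t)
  have hc : Continuous fun t => circlePath r t :=
    hcp.comp (by fun_prop : Continuous fun t => (r, t))
  have := integral_sub_sawtooth_mul hd ((hfc.comp hc).clm_apply (perp.continuous.comp hc))
  simp only
  rw [mul_left_comm, ← this, ← integral_const_mul]
  congr 1
  ext t
  ring

/-- Radial derivatives of compactly supported functions integrate to zero along each ray. -/
lemma integral_angleWeight_mul_radial (hR : 1 < R) (hm : ContDiff ℝ 1 m)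
    (hs : tsupport m ⊆ annulus R) :
    ∫ x in annulus R, angleWeight x * (fderiv ℝ m x x / ‖x‖ ^ 2) = 0 := by
  have hmd := hm.differentiable one_ne_zero
  have hfc := hm.continuous_fderiv one_ne_zero
  have hcp := continuous_circlePath
  rw [integral_annulus_polar]
  have h1 : ∀ p ∈ Ioo 1 R ×ˢ Ioo (-Real.pi) Real.pi,
      p.1 * (angleWeight (circlePath p.1 p.2) * (fderiv ℝ m (circlePath p.1 p.2)
        (circlePath p.1 p.2) / ‖circlePath p.1 p.2‖ ^ 2)) =
      sawtooth p.2 * fderiv ℝ m (circlePath p.1 p.2) (circlePath 1 p.2) := by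
    rintro p ⟨hp1, hp2⟩
    have hp0 : 0 < p.1 := lt_trans one_pos hp1.1
    have : circlePath p.1 p.2 = p.1 • circlePath 1 p.2 := by
      ext i; fin_cases i <;> simp [circlePath]
    rw [angleWeight_circlePath hp0 hp2, norm_circlePath hp0.le]
    nth_rewrite 2 [this]
    rw [map_smul, smul_eq_mul]
    field_simp
  have hc1 : Continuous fun p : ℝ × ℝ => circlePath 1 p.2 :=
    hcp.comp (by fun_prop : Continuous fun p : ℝ × ℝ => ((1 : ℝ), p.2))
  have i1 : IntegrableOn (fun p : ℝ × ℝ => sawtooth p.2 *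
      fderiv ℝ m (circlePath p.1 p.2) (circlePath 1 p.2)) (Ioo 1 R ×ˢ Ioo (-Real.pi) Real.pi) :=
    integrableOn_box_sawtooth (Continuous.continuousOn ((hfc.comp hcp).clm_apply hc1))
  rw [setIntegral_congr_fun (measurableSet_Ioo.prod measurableSet_Ioo) h1]
  rw [Measure.volume_eq_prod, ← Measure.prod_restrict, integral_prod_symm _
    (by rw [Measure.prod_restrict]; exact i1)]
  have hz : ∀ r t, 0 ≤ r → r ∉ Ioo 1 R → m (circlePath r t) = 0 := fun r t hr h =>
    image_eq_zero_of_notMem_tsupport fun h' => h (by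
      have := mem_annulus.1 (hs h')
      rwa [norm_circlePath hr] at this)
  refine integral_eq_zero_of_ae (ae_of_all _ fun t => ?_)
  simp only [Pi.zero_apply]
  have hc : Continuous fun r => circlePath r t :=
    hcp.comp (by fun_prop : Continuous fun r => (r, t))
  rw [integral_const_mul, ← integral_Ioc_eq_integral_Ioo, ← intervalIntegral.integral_of_le hR.le,
    intervalIntegral.integral_eq_sub_of_hasDerivAt (f := fun r => m (circlePath r t))
      (f' := fun r => fderiv ℝ m (circlePath r t) (circlePath 1 t))
      (fun r _ => (hmd (circlePath r t)).hasFDerivAt.comp_hasDerivAt r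
        (hasDerivAt_circlePath_radius r t))
      (Continuous.intervalIntegrable ((hfc.comp hc).clm_apply continuous_const) _ _),
    hz R t (by linarith) (by simp), hz 1 t zero_le_one (by simp)]
  simp

end

/-! ### Identities for test fields -/

section

variable {R : ℝ} {A u : Plane → Plane} {B Du : Fin 2 → Plane → Plane}

lemma h1Functional_eq_integral (hA : MemLp A 2 (annulusMeasure R))
    (hB : ∀ i, MemLp (B i) 2 (annulusMeasure R)) (hu : MemLp u 2 (annulusMeasure R))
    (hDu : ∀ i, MemLp (Du i) 2 (annulusMeasure R)) :
    h1Functional R A B u Du = ∫ x in annulus R,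
      (inner ℝ (A x) (u x) + (inner ℝ (B 0 x) (Du 0 x) + inner ℝ (B 1 x) (Du 1 x))) := by
  have i1 := integrable_inner_of_memLp hA hu
  have i2 := fun i => integrable_inner_of_memLp (hB i) (hDu i)
  have e1 := integral_add i1 ((i2 0).add (i2 1))
  have e2 := integral_add (i2 0) (i2 1)
  simp only [Pi.add_apply] at e1
  rw [e1, e2, h1Functional, Fin.sum_univ_two]

lemma memLp_grad {w : Plane → Plane} (hw : ContDiff ℝ 1 w) (i : Fin 2) :
    MemLp (grad w i) 2 (annulusMeasure R) :=
  memLp_of_continuousOn (continuous_grad hw i).continuousOn 2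

lemma memLp_smooth {w : Plane → Plane} (hw : ContDiff ℝ 1 w) : MemLp w 2 (annulusMeasure R) :=
  memLp_of_continuousOn hw.continuous.continuousOn 2

/-- A functional which vanishes on smooth compactly supported fields vanishes on `H¹₀`. -/
lemma h1Functional_eq_zero (hA : MemLp A 2 (annulusMeasure R))
    (hB : ∀ i, MemLp (B i) 2 (annulusMeasure R)) (hu : IsH10 (annulus R) u Du)
    (h : ∀ w : Plane → Plane, ContDiff ℝ (⊤ : ℕ∞) w → HasCompactSupport w →
      tsupport w ⊆ annulus R → ∫ x in annulus R, (inner ℝ (A x) (w x) +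
        (inner ℝ (B 0 x) (grad w 0 x) + inner ℝ (B 1 x) (grad w 1 x))) = 0) :
    ∫ x in annulus R, (inner ℝ (A x) (u x) +
      (inner ℝ (B 0 x) (Du 0 x) + inner ℝ (B 1 x) (Du 1 x))) = 0 := by
  obtain ⟨w, hw, hlim⟩ := hu.approx
  have h1 := tendsto_h1Functional hA hB (fun n => (hw n).1) hu.toIsH1 hlim
  have h2 : ∀ n, h1Functional R A B (w n) (grad (w n)) = 0 := fun n => by
    have hw1 := contDiff_one_of_smooth (hw n).1
    rw [h1Functional_eq_integral hA hB (memLp_smooth hw1) (memLp_grad hw1)]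
    exact h _ (hw n).1 (hw n).2.1 (hw n).2.2
  rw [← h1Functional_eq_integral hA hB hu.memLp hu.memLp_deriv]
  exact tendsto_nhds_unique h1 (by
    have : (fun n => h1Functional R A B (w n) fun i x => fderiv ℝ (w n) x (basisVec i)) =
      fun _ => 0 := funext h2
    rw [this]; exact tendsto_const_nhds)

lemma continuousOn_inv_norm_sq (R : ℝ) :
    ContinuousOn (fun x : Plane => (‖x‖ ^ 2)⁻¹) (closedAnnulus R) :=
  ContinuousOn.inv₀ (by fun_prop) fun x hx => pow_ne_zero 2 (norm_ne_zero_of_mem hx)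

lemma memLp_angleWeight_smul {g : Plane → Plane} (hg : MemLp g 2 (annulusMeasure R)) :
    MemLp (fun x => angleWeight x • g x) 2 (annulusMeasure R) :=
  memLp_bdd_smul measurable_angleWeight.aestronglyMeasurable abs_angleWeight_le hg

lemma memLp_basisVec (i : Fin 2) : MemLp (fun _ => basisVec i) 2 (annulusMeasure R) :=
  memLp_const _

lemma memLp_inv_smul {L : Plane → Plane} (hL : Continuous L) :
    MemLp (fun x => (‖x‖ ^ 2)⁻¹ • L x) 2 (annulusMeasure R) :=
  memLp_of_continuousOn ((continuousOn_inv_norm_sq R).smul hL.continuousOn) 2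

variable {φ : Plane → Plane} {Dφ : Fin 2 → Plane → Plane}

/-- The flux of an `H¹` field as the value of a bounded functional. For smooth `φ` and
`m = x^⊥ · φ` the integrand is `(m - angleWeight · ∂_θ m) / ‖x‖²`, where `∂_θ` is the derivative
along `x^⊥`; hence the flux does not depend on the approximating sequence in the definition of the
trace. -/
lemma HasFlux.eq_integral {Φ : ℝ} (hu : IsH1 (annulus R) φ Dφ) (h : HasFlux R φ Dφ Φ) :
    ∫ x in annulus R, (inner ℝ ((‖x‖ ^ 2)⁻¹ • perp x + angleWeight x • ((‖x‖ ^ 2)⁻¹ • x)) (φ x) +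
      (inner ℝ (-(angleWeight x • ((‖x‖ ^ 2)⁻¹ • (perp x 0 • perp x)))) (Dφ 0 x) +
        inner ℝ (-(angleWeight x • ((‖x‖ ^ 2)⁻¹ • (perp x 1 • perp x)))) (Dφ 1 x))) =
      2 * Real.pi * Φ := by
  obtain ⟨g, ⟨hg, w, hw, hlim, hlim2⟩, rfl⟩ := h
  have hA : MemLp (fun x => (‖x‖ ^ 2)⁻¹ • perp x + angleWeight x • ((‖x‖ ^ 2)⁻¹ • x)) 2
      (annulusMeasure R) :=
    (memLp_inv_smul perp.continuous).add (memLp_angleWeight_smul (memLp_inv_smul continuous_id))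
  have hB : ∀ i, MemLp (fun x => -(angleWeight x • ((‖x‖ ^ 2)⁻¹ • (perp x i • perp x)))) 2
      (annulusMeasure R) := fun i =>
    (memLp_angleWeight_smul (memLp_inv_smul (L := fun x => perp x i • perp x) (by fun_prop))).neg
  have h1 := tendsto_h1Functional hA hB hw hu hlim
  rw [h1Functional_eq_integral hA hB hu.memLp hu.memLp_deriv] at h1
  have hcut : ∀ (v : Plane → Plane), ContDiff ℝ 1 v →
      MemLp (fun t => v (cutPath t)) 2 (volume.restrict (Ioo 1 R)) := by
    intro v hv
    have hc : Continuous fun t => v (cutPath t) := hv.continuous.comp continuous_cutPath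
    obtain ⟨C, hC⟩ := isCompact_Icc.exists_bound_of_continuousOn (hc.continuousOn (s := Icc 1 R))
    refine MemLp.of_bound hc.aestronglyMeasurable C ?_
    filter_upwards [ae_restrict_mem measurableSet_Ioo] with t ht
    exact hC t (Ioo_subset_Icc_self ht)
  have h2 := (tendsto_integral_inner (memLp_const (basisVec 1))
    (fun n => hcut (w n) (contDiff_one_of_smooth (hw n))) hg hlim2).const_mul (2 * Real.pi)
  have e2 : ∀ v : Plane, inner ℝ (basisVec 1) v = v 1 := fun v => by simp [inner_eq]
  simp only [e2] at h2
  refine tendsto_nhds_unique h1 (h2.congr fun n => ?_)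
  have hw1 := contDiff_one_of_smooth (hw n)
  have hm : ContDiff ℝ 1 fun x => inner ℝ (perp x) (w n x) := perp.contDiff.inner ℝ hw1
  have e3 := integral_sub_angleWeight_mul (R := R) hm
  have e4 : ∀ r ∈ Ioo 1 R, r⁻¹ * inner ℝ (perp (circlePath r 0)) (w n (circlePath r 0)) =
      w n (cutPath r) 1 := by
    intro r hr
    have : circlePath r 0 = cutPath r := by simp [circlePath, cutPath]
    have hr0 : r ≠ 0 := (lt_trans one_pos hr.1).ne'
    rw [this, inner_eq]
    simp [cutPath, hr0]
  rw [← setIntegral_congr_fun measurableSet_Ioo e4, ← e3]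
  change _ = h1Functional R _ _ (w n) (grad (w n))
  rw [h1Functional_eq_integral hA hB (memLp_smooth hw1) (memLp_grad hw1)]
  congr 1
  ext x
  have hd := perp.hasFDerivAt.inner ℝ (hw1.differentiable one_ne_zero x).hasFDerivAt
  rw [hd.fderiv, ContinuousLinearMap.comp_apply, fderivInnerCLM_apply]
  simp only [ContinuousLinearMap.prod_apply]
  rw [map_eq_basisVec (fderiv ℝ (w n) x) (perp x)]
  simp [inner_eq, grad]
  ring

/-- Divergence-free fields of `H¹₀` with zero flux are orthogonal to `θ̂ / ρ`, whose potential is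
the multivalued angle: the flux functional differs from the pairing with `θ̂ / ρ` by the pairings of
`angleWeight` with `div φ` and with a radial derivative, and both vanish. -/
lemma IsTestField.integral_perp (hR : 1 < R) (h : IsTestField R φ Dφ) :
    ∫ x in annulus R, inner ℝ (perp x) (φ x) / ‖x‖ ^ 2 = 0 := by
  have hA : MemLp (fun x : Plane => angleWeight x • ((‖x‖ ^ 2)⁻¹ • x)) 2 (annulusMeasure R) :=
    memLp_angleWeight_smul (memLp_inv_smul continuous_id)
  have hB1 : ∀ i, MemLp (fun x => angleWeight x • ((‖x‖ ^ 2)⁻¹ • (perp x i • perp x))) 2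
      (annulusMeasure R) := fun i =>
    memLp_angleWeight_smul (memLp_inv_smul (L := fun x => perp x i • perp x) (by fun_prop))
  have hB2 : ∀ i, MemLp (fun x => angleWeight x • basisVec i) 2 (annulusMeasure R) :=
    fun i => memLp_angleWeight_smul (memLp_basisVec i)
  have h1 := h1Functional_eq_zero hA
    (B := fun i x => -(angleWeight x • ((‖x‖ ^ 2)⁻¹ • (perp x i • perp x))) +
      angleWeight x • basisVec i) (fun i => (hB1 i).neg.add (hB2 i)) h.h10 ?_
  · have h2 := h.flux.eq_integral h.h10.toIsH1
    rw [mul_zero] at h2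
    have hA2 : MemLp (fun x => (‖x‖ ^ 2)⁻¹ • perp x) 2 (annulusMeasure R) :=
      memLp_inv_smul perp.continuous
    have i1 := (integrable_inner_of_memLp hA h.h10.memLp).add
      ((integrable_inner_of_memLp ((hB1 0).neg.add (hB2 0)) (h.h10.memLp_deriv 0)).add
      (integrable_inner_of_memLp ((hB1 1).neg.add (hB2 1)) (h.h10.memLp_deriv 1)))
    have i2 := (integrable_inner_of_memLp (hA2.add hA) h.h10.memLp).add
      ((integrable_inner_of_memLp (hB1 0).neg (h.h10.memLp_deriv 0)).add
      (integrable_inner_of_memLp (hB1 1).neg (h.h10.memLp_deriv 1)))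
    have h3 := integral_sub i2 i1
    refine Eq.trans (integral_congr_ae ?_) (h3.trans ((congrArg₂ _ h2 h1).trans (sub_zero 0)))
    filter_upwards [h.div_free] with x hx
    simp only [divOf, Fin.sum_univ_two] at hx
    simp [inner_eq]
    linear_combination angleWeight x * hx
  · intro w hw hc hs
    have hw1 := contDiff_one_of_smooth hw
    have hn : ContDiff ℝ 1 fun x : Plane => inner ℝ x (w x) := contDiff_id.inner ℝ hw1
    rw [← integral_angleWeight_mul_radial hR hn ((closure_mono fun x hx => by
      contrapose! hx
      simp only [Function.mem_support, not_not] at hx ⊢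
      simp [hx] : tsupport (fun x : Plane => inner ℝ x (w x)) ⊆ tsupport w).trans hs)]
    refine setIntegral_congr_fun (measurableSet_annulus R) fun x hx => ?_
    have hx0 := norm_ne_zero_of_mem (annulus_subset_closedAnnulus R hx)
    have hd := (hasFDerivAt_id x).inner ℝ (hw1.differentiable one_ne_zero x).hasFDerivAt
    have hd' : fderiv ℝ (fun x => inner ℝ x (w x)) x = _ := hd.fderiv
    have hns := norm_sq_eq x
    simp only
    rw [hd', ContinuousLinearMap.comp_apply, fderivInnerCLM_apply]
    simp only [ContinuousLinearMap.prod_apply]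
    rw [map_eq_basisVec (fderiv ℝ w x) x]
    simp [inner_eq, grad]
    field_simp
    rw [hns]
    ring

/-- Divergence-free fields of `H¹₀` are orthogonal to radial forces `G(‖x‖²) x`, which are
gradients. -/
lemma integral_radial_force (hR : 1 < R) (hφ : IsH10 (annulus R) φ Dφ)
    (hdiv : ∀ᵐ x ∂(annulusMeasure R), divOf Dφ x = 0) {G : ℝ → ℝ} (hG : Integrable G)
    (hG2 : MemLp (fun x : Plane => G (‖x‖ ^ 2) • x) 2 (annulusMeasure R)) :
    ∫ x in annulus R, inner ℝ (G (‖x‖ ^ 2) • x) (φ x) = 0 := by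
  have hH : Continuous fun x : Plane => 0 + ∫ t in (1 : ℝ)..‖x‖ ^ 2, G t := by
    have h1 : Continuous fun s => ∫ t in (1 : ℝ)..s, G t :=
      intervalIntegral.continuous_primitive (fun a b => hG.intervalIntegrable) 1
    exact continuous_const.add (h1.comp (by fun_prop))
  have hB : ∀ i, MemLp (fun x : Plane => (0 + ∫ t in (1 : ℝ)..‖x‖ ^ 2, G t) • basisVec i) 2
      (annulusMeasure R) := fun i =>
    memLp_of_continuousOn (hH.smul continuous_const).continuousOn 2
  have h1 := h1Functional_eq_zero (hG2.const_smul (2 : ℝ)) hB hφ ?_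
  · rw [← mul_right_inj' (two_ne_zero (α := ℝ)), mul_zero, ← integral_const_mul, ← h1]
    refine integral_congr_ae ?_
    filter_upwards [hdiv] with x hx
    simp only [divOf, Fin.sum_univ_two] at hx
    simp [inner_eq]
    linear_combination (-∫ t in (1 : ℝ)..‖x‖ ^ 2, G t) * hx
  · intro w hw hc hs
    have hw1 := contDiff_one_of_smooth hw
    have e1 := integral_mul_divOf hR hw1 hc hs hG 0
    have e2 := integral_add (integrable_inner_of_memLp (hG2.const_smul (2 : ℝ))
      (memLp_smooth hw1)) ((integrable_inner_of_memLp (hB 0) (memLp_grad hw1 0)).add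
      (integrable_inner_of_memLp (hB 1) (memLp_grad hw1 1)))
    refine e2.trans ?_
    have e3 : ∫ x in annulus R, inner ℝ (((2 : ℝ) • fun x : Plane => G (‖x‖ ^ 2) • x) x) (w x) =
        2 * ∫ x in annulus R, G (‖x‖ ^ 2) * inner ℝ x (w x) := by
      rw [← integral_const_mul]
      congr 1
      ext x
      simp [inner_eq]
      ring
    have e4 : ∀ x, (fun x => inner ℝ ((0 + ∫ t in (1 : ℝ)..‖x‖ ^ 2, G t) • basisVec 0) (grad w 0 x))
        x + inner ℝ ((0 + ∫ t in (1 : ℝ)..‖x‖ ^ 2, G t) • basisVec 1) (grad w 1 x) =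
        (0 + ∫ t in (1 : ℝ)..‖x‖ ^ 2, G t) * divOf (grad w) x := by
      intro x
      simp [inner_eq, divOf, Fin.sum_univ_two]
      ring
    rw [e3]
    refine (congrArg _ ((integral_congr_ae (ae_of_all _ e4)).trans e1)).trans ?_
    ring

/-- The weak form of the Laplacian of a swirling field, for test fields in `H¹₀`. -/
lemma integral_gradProd_swirl_of_isH10 (hR : 1 < R) (hφ : IsH10 (annulus R) φ Dφ) {B G : ℝ → ℝ}
    (hB : Continuous B) (hG : Integrable G)
    (hG2 : MemLp (fun x : Plane => G (‖x‖ ^ 2) • ((‖x‖ ^ 2)⁻¹ • perp x)) 2 (annulusMeasure R))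
    (c : ℝ)
    (hBG : ∀ s ∈ Icc 1 (R ^ 2), s ^ 2 * B s = c + ∫ t in (1 : ℝ)..s, G t) :
    ∫ x in annulus R, gradProd (grad (swirl B)) Dφ x =
      -4 * ∫ x in annulus R, inner ℝ (G (‖x‖ ^ 2) • ((‖x‖ ^ 2)⁻¹ • perp x)) (φ x) := by
  have hBm : ∀ i, MemLp (grad (swirl B) i) 2 (annulusMeasure R) := fun i =>
    memLp_of_continuousOn (continuous_grad_swirl hB i).continuousOn 2
  have hA := hG2.const_smul (4 : ℝ)
  have hgp : ∀ (Dw : Fin 2 → Plane → Plane) x, inner ℝ (grad (swirl B) 0 x) (Dw 0 x) +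
      inner ℝ (grad (swirl B) 1 x) (Dw 1 x) = gradProd (grad (swirl B)) Dw x := by
    intro Dw x
    simp [inner_eq, gradProd, Fin.sum_univ_two]
  have key : ∀ (v : Plane → Plane) (Dv : Fin 2 → Plane → Plane), MemLp v 2 (annulusMeasure R) →
      (∀ i, MemLp (Dv i) 2 (annulusMeasure R)) → ∫ x in annulus R, (inner ℝ
        (((4 : ℝ) • fun x : Plane => G (‖x‖ ^ 2) • ((‖x‖ ^ 2)⁻¹ • perp x)) x) (v x) +
        (inner ℝ (grad (swirl B) 0 x) (Dv 0 x) + inner ℝ (grad (swirl B) 1 x) (Dv 1 x))) =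
      4 * (∫ x in annulus R, inner ℝ (G (‖x‖ ^ 2) • ((‖x‖ ^ 2)⁻¹ • perp x)) (v x)) +
        ∫ x in annulus R, gradProd (grad (swirl B)) Dv x := by
    intro v Dv hv hDv
    refine (integral_add (integrable_inner_of_memLp hA hv)
      ((integrable_inner_of_memLp (hBm 0) (hDv 0)).add
      (integrable_inner_of_memLp (hBm 1) (hDv 1)))).trans ?_
    rw [← integral_const_mul]
    congr 1
    · congr 1
      ext x
      rw [Pi.smul_apply, real_inner_smul_left]
    · exact integral_congr_ae (ae_of_all _ fun x => hgp Dv x)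
  have h1 := h1Functional_eq_zero hA hBm hφ ?_
  · rw [key _ _ hφ.memLp hφ.memLp_deriv] at h1
    linarith
  · intro w hw hc hs
    have hw1 := contDiff_one_of_smooth hw
    rw [key _ _ (memLp_smooth hw1) (memLp_grad hw1),
      integral_gradProd_swirl hR hw hc hs hB hG c hBG]
    have : ∫ x in annulus R, inner ℝ (G (‖x‖ ^ 2) • ((‖x‖ ^ 2)⁻¹ • perp x)) (w x) =
        ∫ x in annulus R, G (‖x‖ ^ 2) * (inner ℝ (perp x) (w x) / ‖x‖ ^ 2) := by
      congr 1
      ext x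
      rw [real_inner_smul_left, real_inner_smul_left]
      ring
    rw [this]
    ring

end

/-! ### Rotations and rotationally invariant fields -/

lemma rot_apply (φ : ℝ) (x : Plane) : Matrix.toEuclideanLin (rotMatrix φ) x =
    !₂[Real.cos φ * x 0 - Real.sin φ * x 1, Real.sin φ * x 0 + Real.cos φ * x 1] := by
  ext i
  fin_cases i <;> simp [Matrix.toLpLin_apply, rotMatrix, dotProduct, Fin.sum_univ_two]
  ring

lemma rot_transpose_apply (φ : ℝ) (x : Plane) : Matrix.toEuclideanLin (rotMatrix φ).transpose x =
    !₂[Real.cos φ * x 0 + Real.sin φ * x 1, -Real.sin φ * x 0 + Real.cos φ * x 1] := by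
  ext i
  fin_cases i <;> simp [Matrix.toLpLin_apply, rotMatrix]

lemma norm_rot (φ : ℝ) (x : Plane) : ‖Matrix.toEuclideanLin (rotMatrix φ) x‖ = ‖x‖ := by
  refine (pow_left_inj₀ (norm_nonneg _) (norm_nonneg _) two_ne_zero).1 ?_
  rw [norm_sq_eq, norm_sq_eq, rot_apply]
  simp
  linear_combination (x 0 ^ 2 + x 1 ^ 2) * Real.cos_sq_add_sin_sq φ

lemma measurePreserving_rot (R φ : ℝ) : MeasurePreserving (Matrix.toEuclideanLin (rotMatrix φ))
    (annulusMeasure R) (annulusMeasure R) := by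
  let e : Plane →ₗᵢ[ℝ] Plane := ⟨Matrix.toEuclideanLin (rotMatrix φ), norm_rot φ⟩
  have h1 : MeasurePreserving (e.toLinearIsometryEquiv rfl) volume volume :=
    (e.toLinearIsometryEquiv rfl).measurePreserving
  have h2 := h1.restrict_preimage (measurableSet_annulus R)
  have h3 : (e.toLinearIsometryEquiv rfl) ⁻¹' annulus R = annulus R := by
    ext x
    rw [mem_preimage, mem_annulus, mem_annulus, LinearIsometryEquiv.norm_map]
  rw [h3] at h2
  exact h2

lemma rot_circlePath (φ r t : ℝ) :
    Matrix.toEuclideanLin (rotMatrix φ) (circlePath r t) = circlePath r (φ + t) := by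
  rw [rot_apply]
  ext i
  fin_cases i <;> simp [circlePath, Real.cos_add, Real.sin_add] <;> ring

lemma exists_eq_circlePath (x : Plane) : ∃ t, x = circlePath ‖x‖ t := by
  have hn : ‖(⟨x 0, x 1⟩ : ℂ)‖ = ‖x‖ := by
    refine (pow_left_inj₀ (norm_nonneg _) (norm_nonneg _) two_ne_zero).1 ?_
    rw [norm_sq_eq, Complex.sq_norm, Complex.normSq_mk]
    ring
  refine ⟨Complex.arg ⟨x 0, x 1⟩, ?_⟩
  have h1 := Complex.norm_mul_cos_arg ⟨x 0, x 1⟩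
  have h2 := Complex.norm_mul_sin_arg ⟨x 0, x 1⟩
  rw [hn] at h1 h2
  ext i
  fin_cases i
  · simpa [circlePath] using h1.symm
  · simpa [circlePath] using h2.symm

section

variable {R : ℝ}

/-- A rotationally invariant function is almost everywhere equal to its average over circles. -/
lemma exists_radial_of_invariant {h : Plane → ℝ} (hh : AEStronglyMeasurable h (annulusMeasure R))
    (hinv : ∀ φ ∈ Icc (0 : ℝ) (2 * Real.pi), ∀ᵐ ξ ∂(annulusMeasure R),
      h ξ = h (Matrix.toEuclideanLin (rotMatrix φ) ξ)) :
    ∃ F : ℝ → ℝ, ∀ᵐ ξ ∂(annulusMeasure R), h ξ = F (‖ξ‖ ^ 2) := by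
  have hpi := Real.pi_pos
  set k := hh.mk h with hk
  have hkm : Measurable k := hh.stronglyMeasurable_mk.measurable
  have hhk : h =ᵐ[annulusMeasure R] k := hh.ae_eq_mk
  have hkinv : ∀ φ ∈ Icc (0 : ℝ) (2 * Real.pi), ∀ᵐ ξ ∂(annulusMeasure R),
      k ξ = k (Matrix.toEuclideanLin (rotMatrix φ) ξ) := by
    intro φ hφ
    filter_upwards [hinv φ hφ, hhk, (measurePreserving_rot R φ).quasiMeasurePreserving.ae hhk]
      with ξ h1 h2 h3
    rw [← h2, h1, h3]
  have hrot : Measurable fun p : ℝ × Plane => Matrix.toEuclideanLin (rotMatrix p.1) p.2 := by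
    simp only [rot_apply]
    refine Continuous.measurable ((PiLp.continuous_toLp 2 _).comp (continuous_pi fun i => ?_))
    fin_cases i <;> simp <;> fun_prop
  have hms : MeasurableSet
      {p : ℝ × Plane | k p.2 = k (Matrix.toEuclideanLin (rotMatrix p.1) p.2)} :=
    measurableSet_eq_fun (hkm.comp measurable_snd) (hkm.comp hrot)
  have hae : ∀ᵐ φ ∂(volume.restrict (Ioc 0 (2 * Real.pi))), ∀ᵐ ξ ∂(annulusMeasure R),
      k ξ = k (Matrix.toEuclideanLin (rotMatrix φ) ξ) := by
    filter_upwards [ae_restrict_mem measurableSet_Ioc] with φ hφ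
    exact hkinv φ (Ioc_subset_Icc_self hφ)
  rw [Measure.ae_ae_comm hms] at hae
  refine ⟨fun s => (2 * Real.pi)⁻¹ * ∫ φ in (0 : ℝ)..2 * Real.pi, k (circlePath √s φ), ?_⟩
  filter_upwards [hae, hhk] with ξ h1 h2
  obtain ⟨t, ht⟩ := exists_eq_circlePath ξ
  have hper : Function.Periodic (fun φ => k (circlePath ‖ξ‖ φ)) (2 * Real.pi) := fun φ => by
    simp [circlePath]
  have e1 : ∫ φ in (0 : ℝ)..2 * Real.pi, k ξ =
      ∫ φ in (0 : ℝ)..2 * Real.pi, k (circlePath ‖ξ‖ (φ + t)) := by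
    rw [intervalIntegral.integral_of_le (by positivity),
      intervalIntegral.integral_of_le (by positivity)]
    refine integral_congr_ae ?_
    filter_upwards [h1] with φ hφ
    rw [hφ]
    conv_lhs => rw [ht]
    rw [rot_circlePath]
  have e2 := hper.intervalIntegral_add_eq (0 + t) 0
  rw [intervalIntegral.integral_comp_add_right (fun φ => k (circlePath ‖ξ‖ φ)),
    show 2 * Real.pi + t = 0 + t + 2 * Real.pi by ring, e2, zero_add,
    intervalIntegral.integral_const, smul_eq_mul, sub_zero] at e1
  rw [h2, Real.sqrt_sq (norm_nonneg _), ← e1]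
  field_simp

lemma inner_rot_of_eq {φ : ℝ} {a b x : Plane} (L : Plane → Plane)
    (hL : ∀ y, L (Matrix.toEuclideanLin (rotMatrix φ) y) =
      Matrix.toEuclideanLin (rotMatrix φ) (L y))
    (h : a = Matrix.toEuclideanLin (rotMatrix φ).transpose b) :
    inner ℝ a (L x) = inner ℝ b (L (Matrix.toEuclideanLin (rotMatrix φ) x)) := by
  rw [hL, h, rot_transpose_apply, rot_apply, inner_eq, inner_eq]
  simp
  ring

lemma perp_rot (φ : ℝ) (y : Plane) : perp (Matrix.toEuclideanLin (rotMatrix φ) y) =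
    Matrix.toEuclideanLin (rotMatrix φ) (perp y) := by
  rw [rot_apply, rot_apply]
  ext i
  fin_cases i <;> simp <;> ring

lemma norm_perp (x : Plane) : ‖perp x‖ = ‖x‖ := by
  refine (pow_left_inj₀ (norm_nonneg _) (norm_nonneg _) two_ne_zero).1 ?_
  rw [norm_sq_eq, norm_sq_eq]
  simp
  ring

/-- The components of a rotationally invariant field along `L x` (`L` the identity or the quarter
turn) are radial. -/
lemma exists_radial_component {f : Plane → Plane} (hf : MemLp f 2 (annulusMeasure R))
    (hrot : RotInvariant R f) {L : Plane → Plane} (hLc : Continuous L) (hLn : ∀ x, ‖L x‖ = ‖x‖)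
    (hL : ∀ φ y, L (Matrix.toEuclideanLin (rotMatrix φ) y) =
      Matrix.toEuclideanLin (rotMatrix φ) (L y)) :
    ∃ F : ℝ → ℝ, MemLp (fun x => F (‖x‖ ^ 2)) 2 (annulusMeasure R) ∧
      ∀ᵐ x ∂(annulusMeasure R), inner ℝ (f x) (L x) / ‖x‖ ^ 2 = F (‖x‖ ^ 2) := by
  have hm : AEStronglyMeasurable (fun x => inner ℝ (f x) (L x) / ‖x‖ ^ 2) (annulusMeasure R) := by
    have h1 : AEStronglyMeasurable (fun x => inner ℝ (f x) (L x)) (annulusMeasure R) :=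
      hf.1.inner hLc.aestronglyMeasurable
    exact (h1.aemeasurable.div
      (by fun_prop : Measurable fun x : Plane => ‖x‖ ^ 2).aemeasurable).aestronglyMeasurable
  obtain ⟨F, hF⟩ := exists_radial_of_invariant hm fun φ hφ => by
    filter_upwards [hrot φ hφ] with x hx
    rw [norm_rot, inner_rot_of_eq L (hL φ) hx]
  refine ⟨F, MemLp.ae_eq hF (hf.mono hm ?_), hF⟩
  filter_upwards [ae_restrict_mem (measurableSet_annulus R)] with x hx
  have h1 : 1 ≤ ‖x‖ := (mem_annulus.1 hx).1.le
  have h2 := abs_real_inner_le_norm (f x) (L x)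
  rw [hLn] at h2
  rw [Real.norm_eq_abs, abs_div, abs_of_nonneg (sq_nonneg ‖x‖), div_le_iff₀ (by positivity)]
  refine h2.trans (mul_le_mul_of_nonneg_left ?_ (norm_nonneg _))
  nlinarith

/-- A rotationally invariant field is `F(‖x‖²) x^⊥ + G(‖x‖²) x` almost everywhere. -/
lemma RotInvariant.exists_radial {f : Plane → Plane} (hf : MemLp f 2 (annulusMeasure R))
    (hrot : RotInvariant R f) : ∃ F G : ℝ → ℝ,
      MemLp (fun x => F (‖x‖ ^ 2)) 2 (annulusMeasure R) ∧
      MemLp (fun x => G (‖x‖ ^ 2)) 2 (annulusMeasure R) ∧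
      ∀ᵐ x ∂(annulusMeasure R), f x = F (‖x‖ ^ 2) • perp x + G (‖x‖ ^ 2) • x := by
  obtain ⟨F, hF2, hF⟩ := exists_radial_component hf hrot perp.continuous norm_perp perp_rot
  obtain ⟨G, hG2, hG⟩ := exists_radial_component hf hrot (L := fun x => x) continuous_id
    (fun _ => rfl) (fun _ _ => rfl)
  refine ⟨F, G, hF2, hG2, ?_⟩
  filter_upwards [hF, hG, ae_restrict_mem (measurableSet_annulus R)] with x h1 h2 hx
  have hx0 := norm_ne_zero_of_mem (annulus_subset_closedAnnulus R hx)
  have hn := norm_sq_eq x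
  have hn0 : x 0 ^ 2 + x 1 ^ 2 ≠ 0 := by rw [← hn]; positivity
  rw [← h1, ← h2, hn, inner_eq, inner_eq]
  ext i
  fin_cases i <;> simp <;> field_simp <;> ring

lemma swirl_rot (B : ℝ → ℝ) (φ : ℝ) (x : Plane) :
    swirl B x = Matrix.toEuclideanLin (rotMatrix φ).transpose
      (swirl B (Matrix.toEuclideanLin (rotMatrix φ) x)) := by
  rw [swirl, swirl, norm_rot, perp_rot, map_smul, rot_transpose_apply, rot_apply]
  congr 1
  have h := Real.cos_sq_add_sin_sq φ
  ext i
  fin_cases i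
  · simp
    linear_combination x 1 * h
  · simp
    linear_combination (-x 0) * h

lemma rotInvariant_of_ae_eq_swirl {B : ℝ → ℝ} {v : Plane → Plane}
    (hv : v =ᵐ[annulusMeasure R] swirl B) : RotInvariant R v := by
  intro φ _
  filter_upwards [hv, (measurePreserving_rot R φ).quasiMeasurePreserving.ae hv] with x h1 h2
  rw [h1, h2, ← swirl_rot]

end

/-! ### Traces of swirling fields -/

section

variable {R : ℝ}

lemma contDiff_swirl {B : ℝ → ℝ} (hB : ContDiff ℝ (⊤ : ℕ∞) B) :
    ContDiff ℝ (⊤ : ℕ∞) (swirl B) := by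
  have h1 : ContDiff ℝ (⊤ : ℕ∞) fun s => ∫ t in (1 : ℝ)..s, B t := by
    have hd : ∀ s, HasDerivAt (fun s => ∫ t in (1 : ℝ)..s, B t) (B s) s := fun s =>
      (hB.continuous.integral_hasStrictDerivAt 1 s).hasDerivAt
    refine contDiff_infty_iff_deriv.2 ⟨fun s => (hd s).differentiableAt, ?_⟩
    rwa [funext fun s => (hd s).deriv]
  have h2 : ContDiff ℝ (⊤ : ℕ∞) fun x : Plane => ∫ t in (1 : ℝ)..‖x‖ ^ 2, B t :=
    h1.comp (contDiff_norm_sq ℝ)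
  exact (contDiff_const.add h2).smul perp.contDiff

lemma swirl_sub {B C : ℝ → ℝ} (hB : Continuous B) (hC : Continuous C) (x : Plane) :
    swirl B x - swirl C x = swirl (fun t => B t - C t) x := by
  rw [swirl, swirl, swirl, ← sub_smul, intervalIntegral.integral_sub
    (hB.intervalIntegrable _ _) (hC.intervalIntegrable _ _)]
  congr 1
  ring

lemma grad_swirl_sub {B C : ℝ → ℝ} (hB : Continuous B) (hC : Continuous C) (i : Fin 2) (x : Plane) :
    grad (swirl B) i x - grad (swirl C) i x = grad (swirl fun t => B t - C t) i x := by
  rw [grad_swirl hB, grad_swirl hC, grad_swirl (B := fun t => B t - C t) (hB.sub hC),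
    intervalIntegral.integral_sub
    (hB.intervalIntegrable _ _) (hC.intervalIntegrable _ _)]
  module

lemma abs_primitive_le {B : ℝ → ℝ} {δ : ℝ} (hδ : 0 ≤ δ)
    (h : ∀ s ∈ Icc 1 (R ^ 2), |B s| ≤ δ) {x : Plane} (hx : x ∈ closedAnnulus R) :
    |0 + ∫ t in (1 : ℝ)..‖x‖ ^ 2, B t| ≤ R ^ 2 * δ := by
  have hs := norm_sq_mem_Icc hx
  have h1 := intervalIntegral.norm_integral_le_of_norm_le_const (a := 1) (b := ‖x‖ ^ 2) (f := B)
    (C := δ) fun t ht => by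
      rw [uIoc_of_le hs.1] at ht
      exact h t ⟨ht.1.le, ht.2.trans hs.2⟩
  rw [abs_of_nonneg (by linarith [hs.1]), Real.norm_eq_abs] at h1
  rw [zero_add, mul_comm]
  exact h1.trans (mul_le_mul_of_nonneg_left (by linarith [hs.2]) hδ)

lemma norm_swirl_le (hR : 1 < R) {B : ℝ → ℝ} {δ : ℝ} (hδ : 0 ≤ δ)
    (h : ∀ s ∈ Icc 1 (R ^ 2), |B s| ≤ δ) {x : Plane} (hx : x ∈ closedAnnulus R) :
    ‖swirl B x‖ ≤ 3 * R ^ 3 * δ := by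
  rw [swirl, norm_smul, norm_perp, Real.norm_eq_abs]
  calc _ ≤ R ^ 2 * δ * R := by
        gcongr
        · exact abs_primitive_le hδ h hx
        · exact (mem_closedAnnulus.1 hx).2
    _ = R ^ 3 * δ := by ring
    _ ≤ 3 * R ^ 3 * δ := by
        have : 0 ≤ R ^ 3 * δ := by positivity
        linarith

lemma norm_grad_swirl_le (hR : 1 < R) {B : ℝ → ℝ} (hB : Continuous B) {δ : ℝ} (hδ : 0 ≤ δ)
    (h : ∀ s ∈ Icc 1 (R ^ 2), |B s| ≤ δ) {x : Plane} (hx : x ∈ closedAnnulus R) (i : Fin 2) :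
    ‖grad (swirl B) i x‖ ≤ 3 * R ^ 3 * δ := by
  have hxR := (mem_closedAnnulus.1 hx).2
  have hxi : |x i| ≤ R := (PiLp.norm_apply_le x i).trans hxR
  rw [grad_swirl hB]
  refine (norm_add_le _ _).trans ?_
  rw [norm_smul, norm_smul, norm_perp, norm_perp, norm_basisVec, Real.norm_eq_abs,
    Real.norm_eq_abs, abs_mul, abs_mul, abs_two]
  have h1 := abs_primitive_le hδ h hx
  calc _ ≤ R ^ 2 * δ * 1 + 2 * R * δ * R := by
        gcongr
        exact h _ (norm_sq_mem_Icc hx)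
    _ = 3 * R ^ 2 * δ := by ring
    _ ≤ 3 * R ^ 3 * δ := by
        gcongr 3 * ?_ * δ
        exact pow_le_pow_right₀ hR.le (by norm_num)

lemma tendsto_eLpNorm_of_bound {α : Type*} [MeasurableSpace α] {μ : Measure α} [IsFiniteMeasure μ]
    {g : ℕ → α → Plane} {C : ℝ} (h : ∀ n, ∀ᵐ x ∂μ, ‖g n x‖ ≤ C * (1 / ((n : ℝ) + 1))) :
    Tendsto (fun n => eLpNorm (g n) 2 μ) atTop (𝓝 0) := by
  have h1 : Tendsto (fun n : ℕ => μ univ ^ (2 : ENNReal).toReal⁻¹ *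
      ENNReal.ofReal (C * (1 / ((n : ℝ) + 1)))) atTop (𝓝 0) := by
    have h2 := (tendsto_one_div_add_atTop_nhds_zero_nat (𝕜 := ℝ)).const_mul C
    rw [mul_zero] at h2
    have h3 := ENNReal.tendsto_ofReal h2
    rw [ENNReal.ofReal_zero] at h3
    have h4 := ENNReal.Tendsto.const_mul (a := μ univ ^ (2 : ENNReal).toReal⁻¹) h3
      (Or.inr (by finiteness))
    rwa [mul_zero] at h4
  exact tendsto_of_tendsto_of_tendsto_of_le_of_le tendsto_const_nhds h1 (fun _ => zero_le)
    fun n => eLpNorm_le_of_ae_bound (h n)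

/-- Swirling fields with a `C¹` profile are limits, uniformly with their first derivatives on the
closed annulus, of polynomial fields; so their trace along a curve is their restriction. -/
lemma hasTrace_swirl (hR : 1 < R) {B : ℝ → ℝ} (hB : Continuous B) {γ : ℝ → Plane}
    (hγ : Continuous γ) {a b : ℝ} (hmem : ∀ t ∈ Ioo a b, γ t ∈ closedAnnulus R) :
    HasTrace (annulus R) (swirl B) (grad (swirl B)) γ a b (fun t => swirl B (γ t)) := by
  have hsub := annulus_subset_closedAnnulus R
  choose q hq using fun n : ℕ => exists_polynomial_near_of_continuousOn 1 (R ^ 2) B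
    hB.continuousOn (1 / ((n : ℝ) + 1)) (by positivity)
  have hqc : ∀ n, Continuous fun t => (q n).eval t := fun n => (q n).continuous
  have hq' : ∀ n : ℕ, ∀ s ∈ Icc 1 (R ^ 2), |(q n).eval s - B s| ≤ 1 / ((n : ℝ) + 1) :=
    fun n s hs => (hq n s hs).le
  have hδ : ∀ n : ℕ, 0 ≤ 1 / ((n : ℝ) + 1) := fun n => by positivity
  have hb : ∀ n, ∀ x ∈ closedAnnulus R,
      ‖swirl (fun t => (q n).eval t) x - swirl B x‖ ≤ 3 * R ^ 3 * (1 / ((n : ℝ) + 1)) := by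
    intro n x hx
    rw [swirl_sub (hqc n) hB]
    exact norm_swirl_le hR (hδ n) (hq' n) hx
  refine ⟨?_, fun n => swirl fun t => (q n).eval t, fun n => contDiff_swirl (by
      simpa [Polynomial.coe_aeval_eq_eval] using (q n).contDiff_aeval (𝕜 := ℝ) (⊤ : ℕ∞)),
    ⟨tendsto_eLpNorm_of_bound (C := 3 * R ^ 3) fun n => ?_,
      fun i => tendsto_eLpNorm_of_bound (C := 3 * R ^ 3) fun n => ?_⟩,
    tendsto_eLpNorm_of_bound (C := 3 * R ^ 3) fun n => ?_⟩
  · have hc := (continuous_swirl hB).comp hγ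
    obtain ⟨C, hC⟩ := isCompact_Icc.exists_bound_of_continuousOn (hc.continuousOn (s := Icc a b))
    refine MemLp.of_bound hc.aestronglyMeasurable C ?_
    filter_upwards [ae_restrict_mem measurableSet_Ioo] with t ht
    exact hC t (Ioo_subset_Icc_self ht)
  · filter_upwards [ae_restrict_mem (measurableSet_annulus R)] with x hx
    exact hb n x (hsub hx)
  · filter_upwards [ae_restrict_mem (measurableSet_annulus R)] with x hx
    change ‖grad _ i x - _‖ ≤ _
    rw [grad_swirl_sub (hqc n) hB]
    exact norm_grad_swirl_le hR ((hqc n).sub hB) (hδ n) (hq' n) (hsub hx) i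
  · filter_upwards [ae_restrict_mem measurableSet_Ioo] with t ht
    exact hb n _ (hmem t ht)

lemma isH1_swirl {B : ℝ → ℝ} (hB : Continuous B) :
    IsH1 (annulus R) (swirl B) (grad (swirl B)) where
  memLp := memLp_of_continuousOn (continuous_swirl hB).continuousOn 2
  memLp_deriv i := memLp_of_continuousOn (continuous_grad_swirl hB i).continuousOn 2
  weakDeriv := by
    intro ψ hψ hc hs i
    have hψ1 : ContDiff ℝ 1 ψ := hψ.of_le (by exact_mod_cast le_top)
    have hz : ∀ x, x ∉ tsupport ψ → fderiv ℝ ψ x = 0 := fun x hx => by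
      by_contra h
      exact hx (support_fderiv_subset ℝ h)
    have hint : ∀ g : Plane → Plane, Continuous g → (∀ x, x ∉ tsupport ψ → g x = 0) →
        Integrable g :=
      fun g h1 h2 => h1.integrable_of_hasCompactSupport (HasCompactSupport.intro hc h2)
    have hψc := hψ.continuous
    have hψd := continuous_fderiv_apply hψ1 i
    have hgc := continuous_grad_swirl hB i
    have hsc := continuous_swirl hB
    have key := integral_smul_fderiv_eq_neg_fderiv_smul_of_integrable
      (μ := (volume : Measure Plane)) (f := ψ) (g := swirl B) (v := basisVec i)
      (hint _ (hψd.smul hsc) fun x hx => by simp [hz x hx])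
      (hint _ (hψc.smul hgc) fun x hx => by simp [image_eq_zero_of_notMem_tsupport hx])
      (hint _ (hψc.smul hsc) fun x hx => by simp [image_eq_zero_of_notMem_tsupport hx])
      (fun x _ => hψ1.differentiable one_ne_zero x)
      (fun x _ => (hasFDerivAt_swirl hB x).differentiableAt)
    rw [setIntegral_eq_integral_of_forall_compl_eq_zero fun x hx => by
        simp [hz x fun h => hx (hs h)],
      setIntegral_eq_integral_of_forall_compl_eq_zero fun x hx => by
        simp [image_eq_zero_of_notMem_tsupport fun h => hx (hs h)]]
    exact (neg_eq_iff_eq_neg.2 key).symm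

/-! ### Changing representatives -/

variable {u v : Plane → Plane} {Du : Fin 2 → Plane → Plane}

lemma HasTrace.congr {γ : ℝ → Plane} {a b : ℝ} {g : ℝ → Plane}
    (h : HasTrace (annulus R) u Du γ a b g) (huv : u =ᵐ[annulusMeasure R] v) :
    HasTrace (annulus R) v Du γ a b g := by
  obtain ⟨hg, w, hw, hlim, hlim2⟩ := h
  refine ⟨hg, w, hw, ⟨hlim.1.congr fun n => eLpNorm_congr_ae ?_, hlim.2⟩, hlim2⟩
  filter_upwards [huv] with x hx
  rw [hx]

lemma HasFlux.congr {Φ : ℝ} (h : HasFlux R u Du Φ) (huv : u =ᵐ[annulusMeasure R] v) :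
    HasFlux R v Du Φ := by
  obtain ⟨g, hg, hΦ⟩ := h
  exact ⟨g, hg.congr huv, hΦ⟩

lemma IsIncompleteSolutionWith.congr {ω : ℝ} {f : Plane → Plane}
    (h : IsIncompleteSolutionWith R ω f u Du) (huv : u =ᵐ[annulusMeasure R] v) :
    IsIncompleteSolutionWith R ω f v Du where
  h1 :=
    { memLp := h.h1.memLp.ae_eq huv
      memLp_deriv := h.h1.memLp_deriv
      weakDeriv := by
        intro ψ hψ hc hs i
        rw [← h.h1.weakDeriv ψ hψ hc hs i]
        refine integral_congr_ae ?_
        filter_upwards [huv] with x hx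
        rw [hx] }
  div_free := h.div_free
  inner_bc := h.inner_bc.congr huv
  outer_bc := h.outer_bc.congr huv
  weak_eq φ Dφ hφ := by
    rw [← h.weak_eq φ Dφ hφ]
    congr 1
    refine integral_congr_ae ?_
    filter_upwards [huv] with x hx
    simp only [convective, hx]

end

/-! ### Construction of the profile -/

section

variable {R : ℝ}

/-- The two conditions, on the outer boundary value and on the flux, determine the two constants of
the profile: their determinant is nonzero because `2 log R < R - 1 / R`. -/
lemma exists_constants (hR : 1 < R) (y₁ y₂ : ℝ) : ∃ A C : ℝ,
    A * (1 - 1 / R ^ 2) + C * (2 * Real.log R) = y₁ ∧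
    A * ((R ^ 2 - 1) / 2 - Real.log R) + C * (R ^ 2 * Real.log R - (R ^ 2 - 1) / 2) = y₂ := by
  have hR0 : 0 < R := by linarith
  set L := Real.log R with hL
  have hL0 : 0 < L := Real.log_pos hR
  have h1 : 2 * L < R - 1 / R := by
    have h2 := Real.self_lt_sinh_iff.2 hL0
    rw [hL, Real.sinh_log hR0, ← hL] at h2
    rw [one_div]
    linarith
  have hsq : 4 * L ^ 2 < (R - 1 / R) ^ 2 := by nlinarith
  set D := (1 - 1 / R ^ 2) * (R ^ 2 * L - (R ^ 2 - 1) / 2) - 2 * L * ((R ^ 2 - 1) / 2 - L) with hD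
  have hD0 : D ≠ 0 := by
    have : D = (4 * L ^ 2 - (R - 1 / R) ^ 2) / 2 := by
      rw [hD]
      field_simp
      ring
    rw [this]
    have : 4 * L ^ 2 - (R - 1 / R) ^ 2 < 0 := by linarith
    exact (by linarith : (4 * L ^ 2 - (R - 1 / R) ^ 2) / 2 < 0).ne
  refine ⟨(y₁ * (R ^ 2 * L - (R ^ 2 - 1) / 2) - 2 * L * y₂) / D,
    ((1 - 1 / R ^ 2) * y₂ - ((R ^ 2 - 1) / 2 - L) * y₁) / D, ?_, ?_⟩
  · rw [div_mul_eq_mul_div, div_mul_eq_mul_div, ← add_div, div_eq_iff hD0, hD]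
    ring
  · rw [div_mul_eq_mul_div, div_mul_eq_mul_div, ← add_div, div_eq_iff hD0, hD]
    ring

/-- The derivative `B` of the profile: `s² B(s) = A + C s - ∫₁ˢ p` for `s ≥ 1`. The denominator is
frozen for `s < 1`, so that `B` is continuous on the whole line and the field is `C¹` on the
plane. -/
noncomputable def profileDeriv (p : ℝ → ℝ) (A C t : ℝ) : ℝ :=
  (A + C * t - ∫ τ in (1 : ℝ)..t, p τ) / max 1 t ^ 2

lemma max_one_sq_ne_zero (t : ℝ) : (max 1 t) ^ 2 ≠ 0 :=
  pow_ne_zero 2 (lt_of_lt_of_le one_pos (le_max_left 1 t)).ne'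

variable {p : ℝ → ℝ}

lemma continuous_profileDeriv (hp : Integrable p) (A C : ℝ) :
    Continuous (profileDeriv p A C) := by
  have h1 : Continuous fun s => ∫ t in (1 : ℝ)..s, p t :=
    intervalIntegral.continuous_primitive (fun a b => hp.intervalIntegrable) 1
  exact Continuous.div (by fun_prop) (by fun_prop) max_one_sq_ne_zero

lemma integral_profileDeriv (hp : Integrable p) (A C : ℝ) {s : ℝ} (hs : 1 ≤ s) :
    ∫ t in (1 : ℝ)..s, profileDeriv p A C t =
      A * (1 - 1 / s) + C * Real.log s + ∫ t in (1 : ℝ)..s, profileDeriv p 0 0 t := by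
  have hd : ∀ t ∈ uIcc 1 s, HasDerivAt (fun t => -A * t⁻¹ + C * Real.log t)
      (profileDeriv p A C t - profileDeriv p 0 0 t) t := by
    intro t ht
    rw [uIcc_of_le hs] at ht
    have ht0 : t ≠ 0 := (lt_of_lt_of_le one_pos ht.1).ne'
    refine (((hasDerivAt_inv ht0).const_mul (-A)).add
      ((Real.hasDerivAt_log ht0).const_mul C)).congr_deriv ?_
    rw [profileDeriv, profileDeriv, max_eq_right ht.1]
    field_simp
    ring
  have h0 := (continuous_profileDeriv hp A C).intervalIntegrable (μ := volume) 1 s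
  have h1 := (continuous_profileDeriv hp 0 0).intervalIntegrable (μ := volume) 1 s
  have h2 := intervalIntegral.integral_eq_sub_of_hasDerivAt hd (h0.sub h1)
  rw [intervalIntegral.integral_sub h0 h1] at h2
  simp only [inv_one, Real.log_one] at h2
  rw [one_div]
  linarith

lemma swirl_cutPath (B : ℝ → ℝ) (t : ℝ) :
    swirl B (cutPath t) 1 = (∫ τ in (1 : ℝ)..t ^ 2, B τ) * t := by
  simp [swirl, norm_sq_eq, cutPath]

/-- Profiles with prescribed outer boundary value and flux. -/
lemma exists_profile (hR : 1 < R) (hp : Integrable p) (v Φ : ℝ) : ∃ A C : ℝ,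
    ∫ t in (1 : ℝ)..R ^ 2, profileDeriv p A C t = v ∧
    ∫ t in Ioo 1 R, swirl (profileDeriv p A C) (cutPath t) 1 = Φ := by
  obtain ⟨A, C, h1, h2⟩ := exists_constants hR
    (v - ∫ t in (1 : ℝ)..R ^ 2, profileDeriv p 0 0 t)
    (Φ - ∫ t in (1 : ℝ)..R, (∫ τ in (1 : ℝ)..t ^ 2, profileDeriv p 0 0 τ) * t)
  refine ⟨A, C, ?_, ?_⟩
  · rw [integral_profileDeriv hp A C (by nlinarith), Real.log_pow]
    push_cast
    linarith
  · have hc : Continuous fun s => ∫ τ in (1 : ℝ)..s, profileDeriv p 0 0 τ :=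
      intervalIntegral.continuous_primitive
        (fun a b => (continuous_profileDeriv hp 0 0).intervalIntegrable a b) 1
    have hi : IntervalIntegrable (fun t => (∫ τ in (1 : ℝ)..t ^ 2, profileDeriv p 0 0 τ) * t)
        volume 1 R :=
      ((hc.comp (continuous_pow 2)).mul continuous_id).intervalIntegrable _ _
    have hi2 : IntervalIntegrable (fun t => A * (t - t⁻¹) + C * (2 * t * Real.log t))
        volume 1 R := by
      refine ContinuousOn.intervalIntegrable ?_
      rw [uIcc_of_le hR.le]
      have h0 : ∀ t ∈ Icc 1 R, t ≠ 0 := fun t ht => (lt_of_lt_of_le one_pos ht.1).ne'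
      exact (continuousOn_const.mul (continuousOn_id.sub (continuousOn_id.inv₀ h0))).add
        (continuousOn_const.mul ((continuousOn_const.mul continuousOn_id).mul
          (continuousOn_id.log h0)))
    have hd : ∀ t ∈ uIcc 1 R, HasDerivAt (fun t => A * (t ^ 2 / 2 - Real.log t) +
        C * (t ^ 2 * Real.log t - t ^ 2 / 2)) (A * (t - t⁻¹) + C * (2 * t * Real.log t)) t := by
      intro t ht
      rw [uIcc_of_le hR.le] at ht
      have ht0 : t ≠ 0 := (lt_of_lt_of_le one_pos ht.1).ne'
      have e1 := Real.hasDerivAt_log ht0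
      have e2 := hasDerivAt_pow 2 t
      refine ((((e2.div_const 2).sub e1).const_mul A).add
        (((e2.mul e1).sub (e2.div_const 2)).const_mul C)).congr_deriv ?_
      simp only [Nat.cast_ofNat, Nat.add_one_sub_one, pow_one]
      field_simp
      ring
    have h3 := intervalIntegral.integral_eq_sub_of_hasDerivAt hd hi2
    have h4 : ∀ t ∈ uIcc 1 R, swirl (profileDeriv p A C) (cutPath t) 1 =
        (A * (t - t⁻¹) + C * (2 * t * Real.log t)) +
          (∫ τ in (1 : ℝ)..t ^ 2, profileDeriv p 0 0 τ) * t := by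
      intro t ht
      rw [uIcc_of_le hR.le] at ht
      have ht0 : t ≠ 0 := (lt_of_lt_of_le one_pos ht.1).ne'
      rw [swirl_cutPath, integral_profileDeriv hp A C (by nlinarith [ht.1]), Real.log_pow]
      push_cast
      field_simp
    rw [← integral_Ioc_eq_integral_Ioo, ← intervalIntegral.integral_of_le hR.le,
      intervalIntegral.integral_congr h4, intervalIntegral.integral_add hi2 hi, h3]
    simp only [Real.log_one]
    linarith

/-! ### The incomplete solutions -/

lemma norm_cutPath {t : ℝ} (ht : 0 ≤ t) : ‖cutPath t‖ = t := by
  refine (pow_left_inj₀ (norm_nonneg _) ht two_ne_zero).1 ?_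
  rw [norm_sq_eq]
  simp [cutPath]

lemma cutPath_mem_annulus {t : ℝ} (ht : t ∈ Ioo 1 R) : cutPath t ∈ annulus R := by
  rw [mem_annulus, norm_cutPath (by linarith [ht.1])]
  exact ht

lemma hasFlux_swirl (hR : 1 < R) {B : ℝ → ℝ} (hB : Continuous B) :
    HasFlux R (swirl B) (grad (swirl B)) (∫ t in Ioo 1 R, swirl B (cutPath t) 1) :=
  ⟨_, hasTrace_swirl hR hB continuous_cutPath fun _ ht =>
    annulus_subset_closedAnnulus R (cutPath_mem_annulus ht), rfl⟩

lemma hasTrace_circle_swirl (hR : 1 < R) {B : ℝ → ℝ} (hB : Continuous B) {r : ℝ}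
    (hr : r ∈ Icc 1 R) : HasTrace (annulus R) (swirl B) (grad (swirl B)) (circlePath r) 0
      (2 * Real.pi) (fun t => ((∫ s in (1 : ℝ)..r ^ 2, B s) * r) • thetaHat t) := by
  have hr0 : 0 ≤ r := le_trans zero_le_one hr.1
  have hc : Continuous (circlePath r) :=
    continuous_circlePath.comp (by fun_prop : Continuous fun t => (r, t))
  have h := hasTrace_swirl hR hB hc (a := 0) (b := 2 * Real.pi) fun t _ =>
    mem_closedAnnulus.2 (by rw [norm_circlePath hr0]; exact hr)
  convert h using 2 with t
  rw [swirl, norm_circlePath hr0, zero_add, mul_smul]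
  congr 1
  ext i
  fin_cases i <;> simp [circlePath, thetaHat]

/-- A swirling field solves the system in the incomplete sense as soon as its profile solves the
angular equation up to the multiple `C` of the curl-free field `θ̂ / ρ`. -/
lemma isIncompleteSolutionWith_swirl (hR : 1 < R) {ω : ℝ} {f : Plane → Plane}
    {F G p : ℝ → ℝ} (hF : MemLp (fun x : Plane => F (‖x‖ ^ 2)) 2 (annulusMeasure R))
    (hG : MemLp (fun x : Plane => G (‖x‖ ^ 2)) 2 (annulusMeasure R))
    (hf : ∀ᵐ x ∂(annulusMeasure R), f x = F (‖x‖ ^ 2) • perp x + G (‖x‖ ^ 2) • x)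
    (hp : Integrable p) (hpF : ∀ s ∈ Ioo 1 (R ^ 2), p s = s * F s / 4) {A C : ℝ}
    (hV : ∫ t in (1 : ℝ)..R ^ 2, profileDeriv p A C t = ω / R) :
    IsIncompleteSolutionWith R ω f (swirl (profileDeriv p A C))
      (grad (swirl (profileDeriv p A C))) := by
  have hR0 : R ≠ 0 := by linarith
  set B := profileDeriv p A C with hBdef
  have hB : Continuous B := continuous_profileDeriv hp A C
  refine ⟨isH1_swirl hB, ae_of_all _ (divOf_grad_swirl hB), ?_, ?_, ?_⟩
  · simpa using hasTrace_circle_swirl hR hB (r := 1) ⟨le_rfl, hR.le⟩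
  · have h := hasTrace_circle_swirl hR hB (r := R) ⟨hR.le, le_rfl⟩
    rwa [hV, div_mul_cancel₀ _ hR0] at h
  · intro φ Dφ hφ
    -- the density of `s² B(s)`, cut off outside `[1, R²]`
    set q : ℝ → ℝ := fun t => (Icc 1 (R ^ 2)).indicator (fun _ => C) t - p t with hq
    have hci : Integrable ((Icc 1 (R ^ 2)).indicator fun _ : ℝ => C) :=
      (integrable_indicator_iff measurableSet_Icc).2 (integrableOn_const (by simp))
    have hqi : Integrable q := hci.sub hp
    have hBq : ∀ s ∈ Icc 1 (R ^ 2), s ^ 2 * B s = (A + C) + ∫ t in (1 : ℝ)..s, q t := by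
      intro s hs
      have hs0 : s ≠ 0 := (lt_of_lt_of_le one_pos hs.1).ne'
      have h1 : ∫ t in (1 : ℝ)..s, (Icc 1 (R ^ 2)).indicator (fun _ : ℝ => C) t =
          ∫ t in (1 : ℝ)..s, C := by
        refine intervalIntegral.integral_congr fun t ht => ?_
        rw [uIcc_of_le hs.1] at ht
        exact indicator_of_mem (show t ∈ Icc 1 (R ^ 2) from ⟨ht.1, ht.2.trans hs.2⟩) _
      rw [hq, intervalIntegral.integral_sub hci.intervalIntegrable hp.intervalIntegrable, h1,
        intervalIntegral.integral_const, hBdef, profileDeriv, max_eq_right hs.1]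
      field_simp
      simp
      ring
    have hqpt : ∀ x ∈ annulus R, q (‖x‖ ^ 2) • ((‖x‖ ^ 2)⁻¹ • perp x) =
        C • ((‖x‖ ^ 2)⁻¹ • perp x) - (1 / 4 : ℝ) • (F (‖x‖ ^ 2) • perp x) := by
      intro x hx
      have hs := norm_sq_mem_Ioo hx
      have hx0 := norm_ne_zero_of_mem (annulus_subset_closedAnnulus R hx)
      simp only [hq]
      rw [indicator_of_mem (Ioo_subset_Icc_self hs), hpF _ hs, smul_smul, smul_smul, smul_smul,
        ← sub_smul]
      congr 1
      field_simp
    have hperp : MemLp (fun x => (‖x‖ ^ 2)⁻¹ • perp x) 2 (annulusMeasure R) :=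
      memLp_inv_smul perp.continuous
    have hmul : ∀ (H : ℝ → ℝ) (L : Plane → Plane), Continuous L →
        MemLp (fun x : Plane => H (‖x‖ ^ 2)) 2 (annulusMeasure R) →
        MemLp (fun x => H (‖x‖ ^ 2) • L x) 2 (annulusMeasure R) := fun H L hL hH =>
      (memLp_of_continuousOn hL.continuousOn ⊤).smul hH
    have hFp := hmul F _ perp.continuous hF
    have hGx := hmul G _ continuous_id hG
    have hrad : ∀ H : ℝ → ℝ, MemLp (fun x : Plane => H (‖x‖ ^ 2)) 2 (annulusMeasure R) →
        ∫ x in annulus R, inner ℝ (H (‖x‖ ^ 2) • x) (φ x) = 0 := by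
      intro H hH
      have hi : Integrable ((Ioo 1 (R ^ 2)).indicator H) :=
        (integrable_indicator_iff measurableSet_Ioo).2
          ((integrableOn_radial_iff hR H).1 (hH.integrable one_le_two))
      have he : ∀ x ∈ annulus R, (Ioo 1 (R ^ 2)).indicator H (‖x‖ ^ 2) • x = H (‖x‖ ^ 2) • x :=
        fun x hx => by rw [indicator_of_mem (norm_sq_mem_Ioo hx)]
      rw [← integral_radial_force hR hφ.h10 hφ.div_free hi
        ((hmul H _ continuous_id hH).ae_eq ?_)]
      · refine setIntegral_congr_fun (measurableSet_annulus R) fun x hx => ?_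
        simp only [he x hx]
      · filter_upwards [ae_restrict_mem (measurableSet_annulus R)] with x hx
        exact (he x hx).symm
    have hswirl := integral_gradProd_swirl_of_isH10 hR hφ.h10 hB hqi
      (((hperp.const_smul C).sub (hFp.const_smul (1 / 4 : ℝ))).ae_eq (by
        filter_upwards [ae_restrict_mem (measurableSet_annulus R)] with x hx
        exact (hqpt x hx).symm)) (A + C) hBq
    have i1 := integrable_inner_of_memLp hperp hφ.h10.memLp
    have i2 := integrable_inner_of_memLp hFp hφ.h10.memLp
    have i3 := integrable_inner_of_memLp hGx hφ.h10.memLp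
    have hz : ∫ x in annulus R, inner ℝ ((‖x‖ ^ 2)⁻¹ • perp x) (φ x) = 0 := by
      rw [← hφ.integral_perp hR]
      congr 1
      ext x
      rw [real_inner_smul_left]
      ring
    have e1 : ∫ x in annulus R, inner ℝ (q (‖x‖ ^ 2) • ((‖x‖ ^ 2)⁻¹ • perp x)) (φ x) =
        -(1 / 4) * ∫ x in annulus R, inner ℝ (F (‖x‖ ^ 2) • perp x) (φ x) := by
      have h2 : ∀ x ∈ annulus R, inner ℝ (q (‖x‖ ^ 2) • ((‖x‖ ^ 2)⁻¹ • perp x)) (φ x) =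
          C * inner ℝ ((‖x‖ ^ 2)⁻¹ • perp x) (φ x) +
            -(1 / 4) * inner ℝ (F (‖x‖ ^ 2) • perp x) (φ x) := by
        intro x hx
        rw [hqpt x hx, inner_sub_left, real_inner_smul_left _ _ C,
          real_inner_smul_left _ _ (1 / 4 : ℝ)]
        ring
      rw [setIntegral_congr_fun (measurableSet_annulus R) h2,
        integral_add (i1.const_mul _) (i2.const_mul _), integral_const_mul, integral_const_mul, hz]
      ring
    have hVc := continuous_primitive_norm_sq hB
    simp only [zero_add] at hVc
    have e2 : ∫ x in annulus R, inner ℝ (convective (swirl B) (grad (swirl B)) x) (φ x) = 0 := by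
      have h3 := hrad (fun s => -(∫ t in (1 : ℝ)..s, B t) ^ 2)
        (memLp_of_continuousOn (hVc.pow 2).neg.continuousOn 2)
      rw [← h3]
      congr 1
      ext x
      rw [convective_swirl hB, neg_smul]
    have e3 : ∫ x in annulus R, inner ℝ (f x) (φ x) =
        ∫ x in annulus R, inner ℝ (F (‖x‖ ^ 2) • perp x) (φ x) := by
      have h4 := integral_add i2 i3
      have h5 : ∫ x in annulus R, inner ℝ (G (‖x‖ ^ 2) • id x) (φ x) = 0 := hrad G hG
      rw [h5, add_zero] at h4
      rw [← h4]
      refine integral_congr_ae ?_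
      filter_upwards [hf] with x hx
      rw [hx, inner_add_left]
      rfl
    rw [hswirl, e1, e2, e3]
    ring

/-- For every flux there is a swirling incomplete solution. -/
lemma exists_swirl_solution (hR : 1 < R) (ω : ℝ) {f : Plane → Plane}
    (hf : MemLp f 2 (annulusMeasure R)) (hrot : RotInvariant R f) (Φ : ℝ) :
    ∃ B : ℝ → ℝ, Continuous B ∧ IsIncompleteSolutionWith R ω f (swirl B) (grad (swirl B)) ∧
      ∫ t in Ioo 1 R, swirl B (cutPath t) 1 = Φ := by
  obtain ⟨F, G, hF, hG, hfFG⟩ := hrot.exists_radial hf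
  have hFi : IntegrableOn F (Ioo 1 (R ^ 2)) :=
    (integrableOn_radial_iff hR F).1 (hF.integrable one_le_two)
  have hpi : Integrable ((Ioo 1 (R ^ 2)).indicator fun s => s * F s / 4) := by
    refine (integrable_indicator_iff measurableSet_Ioo).2 (Integrable.div_const ?_ 4)
    refine hFi.bdd_mul (c := R ^ 2) (by fun_prop) ?_
    filter_upwards [ae_restrict_mem measurableSet_Ioo] with s hs
    rw [Real.norm_eq_abs, abs_of_pos (lt_trans one_pos hs.1)]
    exact hs.2.le
  obtain ⟨A, C, h1, h2⟩ := exists_profile hR hpi (ω / R) Φ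
  exact ⟨_, continuous_profileDeriv hpi A C, isIncompleteSolutionWith_swirl hR hF hG hfFG hpi
    (fun s hs => indicator_of_mem hs _) h1, h2⟩

end

end TaylorCouette

/-- Existence of infinitely many rotationally invariant incomplete solutions, as elements of
`L²(Ω_R)`, that is, up to equality almost everywhere; and existence of one for every flux. -/
theorem theorem3p4 (R : ℝ) (hR : 1 < R) (ω : ℝ) (hω : 0 ≤ ω)
    (f : TaylorCouette.Plane → TaylorCouette.Plane)
    (hf : MemLp f 2 (TaylorCouette.annulusMeasure R))
    (hf_rot : TaylorCouette.RotInvariant R f) :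
    {u : Lp TaylorCouette.Plane 2 (TaylorCouette.annulusMeasure R) |
      TaylorCouette.RotInvariant R u ∧ TaylorCouette.IsIncompleteSolution R ω f u}.Infinite ∧
    ∀ Φ : ℝ, ∃ u : Lp TaylorCouette.Plane 2 (TaylorCouette.annulusMeasure R),
      TaylorCouette.RotInvariant R u ∧
      TaylorCouette.IsIncompleteSolutionWithFlux R ω f u Φ := by
  open TaylorCouette in
  choose B hB hsol hflux using exists_swirl_solution hR ω hf hf_rot
  have hae : ∀ Φ, (hsol Φ).h1.memLp.toLp (swirl (B Φ)) =ᵐ[annulusMeasure R] swirl (B Φ) :=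
    fun Φ => (hsol Φ).h1.memLp.coeFn_toLp
  refine ⟨Set.infinite_of_injective_forall_mem
    (f := fun Φ : ℝ => (hsol Φ).h1.memLp.toLp (swirl (B Φ))) ?_ fun Φ =>
      ⟨rotInvariant_of_ae_eq_swirl (hae Φ), _, (hsol Φ).congr (hae Φ).symm⟩, fun Φ =>
      ⟨(hsol Φ).h1.memLp.toLp _, rotInvariant_of_ae_eq_swirl (hae Φ), _,
        (hsol Φ).congr (hae Φ).symm, ?_⟩⟩
  · -- solutions with different fluxes differ, because both are continuous
    intro Φ Ψ h
    have h1 : swirl (B Φ) =ᵐ[annulusMeasure R] swirl (B Ψ) :=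
      (MemLp.toLp_eq_toLp_iff _ _).1 h
    have h2 := Measure.eqOn_open_of_ae_eq h1 (isOpen_annulus R)
      (continuous_swirl (hB Φ)).continuousOn (continuous_swirl (hB Ψ)).continuousOn
    rw [← hflux Φ, ← hflux Ψ]
    refine setIntegral_congr_fun measurableSet_Ioo fun t ht => ?_
    simp only [h2 (cutPath_mem_annulus ht)]
  · have h3 := hasFlux_swirl hR (hB Φ)
    rw [hflux] at h3
    exact h3.congr (hae Φ).symm
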